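/- Let $n,k,j$ be integers with $k\ge 0$ and $0\le j\le 2n-2$. Let $\mathbf z=(\mathbf z_{AA'})$, $A=0,\dots,2n-1$, $A'=0',1'$, be the coordinates on $\mathbb C^{2n\times 2}$, let $\omega^0,\dots,\omega^{2n-1}$ be the generators of the Grassmann algebra $\wedge\mathbb C^{2n}$, and put $$\mathcal V_j=\odot^{k-j}\mathbb C^2\otimes\wedge^j\mathbb C^{2n}\ (j\le k),\qquad \mathcal V_j=\odot^{j-k-1}\mathbb C^2\otimes\wedge^{j+1}\mathbb C^{2n}\ (j>k),$$ where $\odot^\sigma\mathbb C^2$ is realized as the homogeneous polynomials of degree $\sigma$ in two commuting variables, denoted $s^{0'},s^{1'}$ for $j\le k$ and $S_{0'},S_{1'}$ for $j\geq k$. For an open set $U$, $\Gamma(U,\mathcal V_j)$ denotes the holomorphic $\mathcal V_j$-valued functions on $U$. Repeated indices are summed. Put $\varepsilon^{0'1'}=-1$, $\varepsilon^{1'0'}=1$, $\varepsilon^{0'0'}=\varepsilon^{1'1'}=0$, $\partial^{A'}=\varepsilon^{B'A'}\,\partial/\partial s^{B'}$, $S^{A'}=S_{B'}\varepsilon^{B'A'}$,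 $\widetilde d_{A'}f=\omega^A\,\partial f/\partial\mathbf z_{AA'}$, and $$\widetilde{\mathcal D}_j=\partial^{A'}\widetilde d_{A'}\ (j<k),\qquad \widetilde{\mathcal D}_k=\widetilde d_{0'}\widetilde d_{1'},\qquad \widetilde{\mathcal D}_j=S^{A'}\widetilde d_{A'}\ (j>k).$$ For $g\in{\rm SL}(2n+2,\mathbb C)$ write $g^{-1}=\begin{pmatrix}\mathbf a&\mathbf b\\ \mathbf c&\mathbf d\end{pmatrix}$ with $\mathbf a$ of size $2\times2$ and $\mathbf d$ of size $2n\times 2n$, and put $J_1=\mathbf a+\mathbf b\mathbf z$, $g^{-1}.\mathbf z=(\mathbf c+\mathbf d\mathbf z)J_1^{-1}$, $J_2=\mathbf d-(\mathbf c+\mathbf d\mathbf z)J_1^{-1}\mathbf b$ on the open set $U_g=\{\mathbf z:\det(\mathbf a+\mathbf b\mathbf z)\ne0\}$. A matrix $M$ acts by the substitutions $M.s^{A'}=M_{B'A'}s^{B'}$, $M.S_{A'}=M_{B'A'}S_{B'}$, $M.\omega^A=M_{BA}\omega^B$, extended multiplicatively to monomials $s^{\mathbf A'}$, $S_{\mathbf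 A'}$, $\omega^{\mathbf A}$. For $\mathbf z\in U_g$ define $$[\widetilde\pi_j(g)f](\mathbf z)=\frac{f_{\mathbf A\mathbf A'}(g^{-1}.\mathbf z)}{\det(\mathbf a+\mathbf b\mathbf z)^{j+1}}\;J_1^{-1}.s^{\mathbf A'}\;J_2^{t}.\omega^{\mathbf A}\quad(j\le k,\ f=f_{\mathbf A\mathbf A'}s^{\mathbf A'}\omega^{\mathbf A}),$$ $$[\widetilde\pi_j(g)f](\mathbf z)=\frac{f_{\mathbf A}^{\mathbf A'}(g^{-1}.\mathbf z)}{\det(\mathbf a+\mathbf b\mathbf z)^{j+1}}\;J_1^{t}.S_{\mathbf A'}\;J_2^{t}.\omega^{\mathbf A}\quad(j>k,\ f=f_{\mathbf A}^{\mathbf A'}S_{\mathbf A'}\omega^{\mathbf A}).$$ **Theorem.** $\widetilde{\mathcal D}_j$ maps $\Gamma(\mathbb C^{2n\times2},\mathcal V_j)$ to $\Gamma(\mathbb C^{2n\times2},\mathcal V_{j+1})$. For every $g\in{\rm SL}(2n+2,\mathbb C)$ and every $f\in\Gamma(\mathbb C^{2n\times 2},\mathcal V_j)$, the function $\widetilde\pi_j(g)f$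 belongs to $\Gamma(U_g,\mathcal V_j)$, and $$\widetilde{\mathcal D}_j\bigl(\widetilde\pi_j(g)f\bigr)=\widetilde\pi_{j+1}(g)\bigl(\widetilde{\mathcal D}_jf\bigr)\qquad\text{on } U_g .$$ -/

import Mathlib

open scoped Matrix

-- The sup norm on matrices; only the (canonical) topology it induces matters.
attribute [local instance] Matrix.normedAddCommGroup Matrix.normedSpace

namespace CauchyFueter

noncomputable section

/-- The affine space `ℂ^{2n×2}` of matrices `z = (z_{AA'})`. -/
abbrev Z (n : ℕ) : Type := Matrix (Fin (2 * n)) (Fin 2) ℂ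

/-- The Grassmann algebra `∧ ℂ^{2n}`, generated by the `ω^A`. -/
abbrev Grass (n : ℕ) : Type := ExteriorAlgebra ℂ (Fin (2 * n) → ℂ)

/-- The coefficients `f_{A₁…A_τ}`, `A₁ < … < A_τ`, of an element of the Grassmann algebra
in the basis of monomials `ω^{A₁} ⋯ ω^{A_τ}`. -/
def coeff (n : ℕ) : Grass n ≃ₗ[ℂ] (Finset (Fin (2 * n)) → ℂ) :=
  (Pi.basisFun ℂ (Fin (2 * n))).ExteriorAlgebra.equivFun

/-- The finite-dimensional space `∧ ℂ^{2n}` is normed by the maximum of the coefficients, so that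
limits and derivatives of `∧ ℂ^{2n}`-valued functions are those of the coefficients. -/
instance grassNormedAddCommGroup (n : ℕ) : NormedAddCommGroup (Grass n) :=
  NormedAddCommGroup.induced (Grass n) (Finset (Fin (2 * n)) → ℂ) (coeff n) (coeff n).injective

instance grassNormedSpace (n : ℕ) : NormedSpace ℂ (Grass n) :=
  NormedSpace.induced ℂ (Grass n) (Finset (Fin (2 * n)) → ℂ) (coeff n).toLinearMap

/-- The Grassmannian variable `ω^A`. -/
def omega {n : ℕ} (A : Fin (2 * n)) : Grass n :=
  ExteriorAlgebra.ι ℂ (Pi.single A 1)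

/-- A function in the supervariables `z_{AA'}`, `s^{A'}` (or `S_{A'}`) and `ω^A`: the dependence on
`z` and on the two commuting variables is functional, that on the `ω^A` is through the value. -/
abbrev SuperFun (n : ℕ) : Type := Z n → (Fin 2 → ℂ) → Grass n

/-- `⊙^σ ℂ² ⊗ ∧^τ ℂ^{2n}`, realized as the homogeneous polynomials of degree `σ` on `ℂ²` with
coefficients in `∧^τ ℂ^{2n}`. -/
def fiber (n σ τ : ℕ) : Set ((Fin 2 → ℂ) → Grass n) :=
  {p | ∃ c : Fin (σ + 1) → Grass n, (∀ i, c i ∈ (⋀[ℂ]^τ (Fin (2 * n) → ℂ))) ∧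
    ∀ s, p s = ∑ i : Fin (σ + 1), (s 0 ^ (i : ℕ) * s 1 ^ (σ - (i : ℕ))) • c i}

/-- The holomorphic functions on `U` with values in `⊙^σ ℂ² ⊗ ∧^τ ℂ^{2n}`. -/
def Sections (n σ τ : ℕ) (U : Set (Z n)) : Set (SuperFun n) :=
  {f | (∀ z ∈ U, f z ∈ fiber n σ τ) ∧ ∀ s, AnalyticOnNhd ℂ (fun z => f z s) U}

/-- The degree of `V_j` in the commuting variables. -/
def degS (k j : ℕ) : ℕ := if j ≤ k then k - j else j - k - 1

/-- The degree of `V_j` in the Grassmannian variables. -/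
def degOmega (k j : ℕ) : ℕ := if j ≤ k then j else j + 1

/-- `Γ(U, V_j)`, where `V_j = ⊙^{k-j} ℂ² ⊗ ∧^j ℂ^{2n}` for `j ≤ k` and
`V_j = ⊙^{j-k-1} ℂ² ⊗ ∧^{j+1} ℂ^{2n}` for `j > k`. -/
def Gam (n k j : ℕ) (U : Set (Z n)) : Set (SuperFun n) :=
  Sections n (degS k j) (degOmega k j) U

/-! ### The operators -/

/-- `∂_{AA'} = ∂/∂z_{AA'}`. -/
def dz {n : ℕ} (A : Fin (2 * n)) (A' : Fin 2) (f : SuperFun n) : SuperFun n :=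
  fun z s => deriv (fun t : ℂ => f (z + t • Matrix.single A A' 1) s) 0

/-- `∂_{A'} = ∂/∂s^{A'}`. -/
def ds {n : ℕ} (A' : Fin 2) (f : SuperFun n) : SuperFun n :=
  fun z s => deriv (fun t : ℂ => f z (s + t • Pi.single A' 1)) 0

/-- `d_{A'} f = ω^A ∂_{AA'} f`. -/
def dTilde {n : ℕ} (A' : Fin 2) (f : SuperFun n) : SuperFun n :=
  fun z s => ∑ A : Fin (2 * n), omega A * dz A A' f z s

/-- The matrix `(ε^{A'B'})`, used to raise primed indices. -/
def eps : Matrix (Fin 2) (Fin 2) ℂ := !![0, -1; 1, 0]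

/-- `∂^{A'} = ∂_{B'} ε^{B'A'}`. -/
def dsUp {n : ℕ} (A' : Fin 2) (f : SuperFun n) : SuperFun n :=
  fun z s => ∑ B' : Fin 2, eps B' A' • ds B' f z s

/-- `S^{A'} = S_{B'} ε^{B'A'}`. -/
def sUp (s : Fin 2 → ℂ) (A' : Fin 2) : ℂ := ∑ B' : Fin 2, s B' * eps B' A'

/-- The operator `D_j`: it is `∂^{A'} d_{A'}` for `j < k`, `d_{0'} d_{1'}` for `j = k` and
`S^{A'} d_{A'}` for `j > k`. -/
def D {n : ℕ} (k j : ℕ) (f : SuperFun n) : SuperFun n :=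
  if j < k then fun z s => ∑ A' : Fin 2, dsUp A' (dTilde A' f) z s
  else if j = k then dTilde 0 (dTilde 1 f)
  else fun z s => ∑ A' : Fin 2, sUp s A' • dTilde A' f z s

/-! ### The action of `SL(2n+2, ℂ)` -/

/-- The square matrices of size `2n+2`, written in blocks `(a, b; c, d)` of sizes `2` and `2n`. -/
abbrev BlockMat (n : ℕ) : Type := Matrix (Fin 2 ⊕ Fin (2 * n)) (Fin 2 ⊕ Fin (2 * n)) ℂ

/-- `SL(2n+2, ℂ)`. -/
abbrev SL (n : ℕ) : Type := Matrix.SpecialLinearGroup (Fin 2 ⊕ Fin (2 * n)) ℂ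

/-- `J₁(h, z) = a + b z`. -/
def J₁ {n : ℕ} (h : BlockMat n) (z : Z n) : Matrix (Fin 2) (Fin 2) ℂ :=
  h.toBlocks₁₁ + h.toBlocks₁₂ * z

/-- The fractional linear transformation `h.z = (c + d z) (a + b z)⁻¹`. -/
def frac {n : ℕ} (h : BlockMat n) (z : Z n) : Z n :=
  (h.toBlocks₂₁ + h.toBlocks₂₂ * z) * (J₁ h z)⁻¹

/-- `J₂(h, z) = d - (c + d z) (a + b z)⁻¹ b`. -/
def J₂ {n : ℕ} (h : BlockMat n) (z : Z n) : Matrix (Fin (2 * n)) (Fin (2 * n)) ℂ :=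
  h.toBlocks₂₂ - (h.toBlocks₂₁ + h.toBlocks₂₂ * z) * (J₁ h z)⁻¹ * h.toBlocks₁₂

/-- The domain of `z ↦ g⁻¹.z`: the complement of the hypersurface `det (a + b z) = 0`, where
`g⁻¹ = (a, b; c, d)`. -/
def regular {n : ℕ} (g : SL n) : Set (Z n) := {z | (J₁ (g⁻¹ : SL n).1 z).det ≠ 0}

/-- The action of a matrix on polynomials in two commuting variables: the substitution
`s^{A'} ↦ M.s^{A'} = M_{B'A'} s^{B'}`. -/
def substS {n : ℕ} (M : Matrix (Fin 2) (Fin 2) ℂ) (p : (Fin 2 → ℂ) → Grass n) :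
    (Fin 2 → ℂ) → Grass n :=
  fun s => p (fun A' => ∑ B' : Fin 2, M B' A' * s B')

/-- The action of a matrix on the Grassmann algebra: the algebra homomorphism with
`ω^A ↦ M.ω^A = M_{BA} ω^B`. -/
def substOmega {n : ℕ} (M : Matrix (Fin (2 * n)) (Fin (2 * n)) ℂ) : Grass n →ₐ[ℂ] Grass n :=
  ExteriorAlgebra.map (Matrix.toLin' M)

theorem substOmega_omega {n : ℕ} (M : Matrix (Fin (2 * n)) (Fin (2 * n)) ℂ) (A : Fin (2 * n)) :
    substOmega M (omega A) = ∑ B : Fin (2 * n), M B A • omega B := by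
  have h : Matrix.toLin' M (Pi.single A 1) = ∑ B, M B A • (Pi.single B 1 : Fin (2 * n) → ℂ) := by
    ext C
    simp [Finset.sum_apply, Pi.single_apply]
  simp only [substOmega, omega, ExteriorAlgebra.map_apply_ι, h, map_sum, map_smul]

/-- The action `π_j(g)` on functions in supervariables. With `g⁻¹ = (a, b; c, d)`, the value at `z`
is `det (a + b z)^{-(j+1)}` times `f(g⁻¹.z)`, in which `ω^A` is replaced by `J₂ᵗ.ω^A`, and the
commuting variables are acted on by `(a + b z)⁻¹` if `j ≤ k` and by `(a + b z)ᵗ` if `j > k`. -/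
def rep {n : ℕ} (k j : ℕ) (g : SL n) (f : SuperFun n) : SuperFun n := fun z s =>
  let h : BlockMat n := (g⁻¹ : SL n).1
  ((J₁ h z).det ^ (j + 1))⁻¹ • substOmega (J₂ h z)ᵀ
    (substS (if j ≤ k then (J₁ h z)⁻¹ else (J₁ h z)ᵀ) (f (frac h z)) s)

end

end CauchyFueter

namespace CauchyFueter

open scoped ContDiff

/-! ### Calculus in the Grassmann algebra -/

/-! Write K = (a + bz)⁻¹, β_{A'} = (Kb)_{A'A} ω^A, and let T_m f (`twist`) be det(a + bz)^{-m} times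
f(h.z, σ(z)) with J₂ᵗ acting on the ω^A. Everything rests on the first-order formula
`sum_omega_mul_deriv_twist`. Differentiating T_m f along E_{AA'} and contracting with ω^A, the
motion of h.z, with velocity J₂ E K, gives Σ K_{A'B'} T_m(d_{B'} f); the motion of J₂ᵗ gives τ
β_{A'} T_m f in Grassmann degree τ (`sum_omega_mul_deriv_substOmega`); the determinant gives -m
β_{A'} T_m f; and the motion of σ gives terms in ∂_{B'} f.

With m = j + 1 the coefficient τ - m is -1 for j ≤ k and 0 for j > k.

For j < k (`D_twist_of_lt`), a further derivative in s leaves unwanted terms symmetric in the two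
primed indices, which ε annihilates. The term K K T_m(∂ d f), antisymmetrized, acquires the factor
det K, which raises the exponent of the determinant by one.

For j > k (`D_twist_of_gt`), the σ-term carries the factor S_{A'} and dies because S^{A'} S_{A'} =
0, while contracting S^{A'} with K gives det K times the transformed S.

For j = k (`D_twist_of_eq`) there is no dependence on s. In the second-order computation the
derivatives of β and K cancel the β-terms, and d_{0'} d_{1'} = -d_{1'} d_{0'}, d_{A'}² = 0 turn K K
into det K.

Holomorphy and the degree statements rest on `sections_coefficients`, which recovers holomorphic
coefficients from a section. -/

instance grassFiniteDimensional (n : ℕ) : FiniteDimensional ℂ (Grass n) :=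
  Module.Finite.equiv (coeff n).symm

/-- The multiplication of the Grassmann algebra as a continuous bilinear map. -/
noncomputable def mulGrass (n : ℕ) : Grass n →L[ℂ] Grass n →L[ℂ] Grass n :=
  (LinearMap.mul ℂ (Grass n)).toContinuousBilinearMap

@[simp] theorem mulGrass_apply {n : ℕ} (u v : Grass n) : mulGrass n u v = u * v := rfl

/-- The inclusion of `ℂ^{2n}` into the Grassmann algebra. -/
noncomputable def iota (n : ℕ) : (Fin (2 * n) → ℂ) →L[ℂ] Grass n :=
  (ExteriorAlgebra.ι ℂ).toContinuousLinearMap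

theorem iota_apply {n : ℕ} (x : Fin (2 * n) → ℂ) : iota n x = ExteriorAlgebra.ι ℂ x := rfl

theorem iota_eq_sum {n : ℕ} (x : Fin (2 * n) → ℂ) : iota n x = ∑ A, x A • omega A := by
  conv_lhs => rw [pi_eq_sum_univ' x]
  simp only [map_sum, map_smul]
  refine Finset.sum_congr rfl fun A _ => ?_
  rw [omega, iota_apply]

theorem iota_mul_iota {n : ℕ} (x y : Fin (2 * n) → ℂ) :
    iota n x * iota n y = -(iota n y * iota n x) :=
  eq_neg_of_add_eq_zero_left (ExteriorAlgebra.ι_add_mul_swap x y)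

theorem substOmega_iota {n : ℕ} (M : Matrix (Fin (2 * n)) (Fin (2 * n)) ℂ)
    (x : Fin (2 * n) → ℂ) : substOmega M (iota n x) = iota n (M *ᵥ x) := by
  simp only [substOmega, iota_apply, ExteriorAlgebra.map_apply_ι, Matrix.toLin'_apply]

/-- `substOmega M` as a continuous linear map. -/
noncomputable def substOmegaL {n : ℕ} (M : Matrix (Fin (2 * n)) (Fin (2 * n)) ℂ) :
    Grass n →L[ℂ] Grass n :=
  (substOmega M).toLinearMap.toContinuousLinearMap

theorem substOmegaL_apply {n : ℕ} (M : Matrix (Fin (2 * n)) (Fin (2 * n)) ℂ) (v : Grass n) :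
    substOmegaL M v = substOmega M v := rfl

/-- The exterior power is the τ-th power of the submodule of degree one, which an induced algebra
homomorphism preserves. -/
theorem substOmega_mem {n τ : ℕ} (M : Matrix (Fin (2 * n)) (Fin (2 * n)) ℂ) {v : Grass n}
    (hv : v ∈ (⋀[ℂ]^τ (Fin (2 * n) → ℂ))) :
    substOmega M v ∈ (⋀[ℂ]^τ (Fin (2 * n) → ℂ)) := by
  have h : (LinearMap.range (ExteriorAlgebra.ι ℂ (M := Fin (2 * n) → ℂ))).map
      (substOmega M).toLinearMap ≤ LinearMap.range (ExteriorAlgebra.ι ℂ) := by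
    rintro _ ⟨_, ⟨x, rfl⟩, rfl⟩
    exact ⟨M *ᵥ x, (substOmega_iota M x).symm⟩
  have h2 := pow_le_pow_left' h τ
  rw [← Submodule.map_pow] at h2
  exact h2 ⟨v, hv, rfl⟩

theorem iota_mul_mem {n τ : ℕ} (x : Fin (2 * n) → ℂ) {v : Grass n}
    (hv : v ∈ (⋀[ℂ]^τ (Fin (2 * n) → ℂ))) :
    iota n x * v ∈ (⋀[ℂ]^(τ + 1) (Fin (2 * n) → ℂ)) := by
  have h := Submodule.mul_mem_mul
    (LinearMap.mem_range_self (ExteriorAlgebra.ι ℂ (M := Fin (2 * n) → ℂ)) x) hv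
  rwa [← pow_succ'] at h

/-! ### Smooth dependence of the substitution on its matrix -/

section Smooth

variable {E : Type*} [NormedAddCommGroup E] [NormedSpace ℂ E] {n : ℕ} {m : ℕ∞ω} {x : E}

theorem contDiffAt_grass_mul {u v : E → Grass n} (hu : ContDiffAt ℂ m u x)
    (hv : ContDiffAt ℂ m v x) : ContDiffAt ℂ m (fun y => u y * v y) x :=
  (mulGrass n).isBoundedBilinearMap.contDiff.comp_contDiffAt x (hu.prodMk hv)

theorem contDiffAt_matrix {p q : Type*} [Fintype p] [Fintype q] {M : E → Matrix p q ℂ} :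
    ContDiffAt ℂ m M x ↔ ∀ i j, ContDiffAt ℂ m (fun y => M y i j) x := by
  constructor
  · intro h i j
    exact contDiffAt_pi.1 (contDiffAt_pi.1 h i) j
  · intro h
    exact contDiffAt_pi.2 fun i => contDiffAt_pi.2 fun j => h i j

/-- On generators the substitution is linear in M; multiplicativity propagates smoothness to
products. -/
theorem contDiffAt_substOmega {M : E → Matrix (Fin (2 * n)) (Fin (2 * n)) ℂ}
    (hM : ContDiffAt ℂ m M x) (v : Grass n) :
    ContDiffAt ℂ m (fun y => substOmega (M y) v) x := by
  induction v using ExteriorAlgebra.induction with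
  | algebraMap r => simpa only [AlgHom.commutes] using contDiffAt_const
  | ι w =>
    simp only [← iota_apply, substOmega_iota]
    refine (iota n).contDiff.comp_contDiffAt x (contDiffAt_pi.2 fun i => ?_)
    simp only [Matrix.mulVec, dotProduct]
    exact ContDiffAt.sum fun j _ => (contDiffAt_matrix.1 hM i j).mul contDiffAt_const
  | mul a b ha hb => simpa only [map_mul] using contDiffAt_grass_mul ha hb
  | add a b ha hb => simpa only [map_add] using ha.add hb

/-- The basis of monomials `ω^{A₁} ⋯ ω^{A_τ}`. -/
noncomputable def grassBasis (n : ℕ) : Module.Basis (Finset (Fin (2 * n))) ℂ (Grass n) :=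
  (Pi.basisFun ℂ (Fin (2 * n))).ExteriorAlgebra

/-- The coordinates with respect to the basis of monomials, as continuous linear forms. -/
noncomputable def grassCoord (n : ℕ) (I : Finset (Fin (2 * n))) : Grass n →L[ℂ] ℂ :=
  ((grassBasis n).coord I).toContinuousLinearMap

theorem sum_grassCoord (v : Grass n) : ∑ I, grassCoord n I v • grassBasis n I = v :=
  (grassBasis n).sum_repr v

theorem substOmega_eq_sum (M : Matrix (Fin (2 * n)) (Fin (2 * n)) ℂ) (v : Grass n) :
    substOmega M v = ∑ I, grassCoord n I v • substOmega M (grassBasis n I) := by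
  conv_lhs => rw [← sum_grassCoord v]
  simp only [map_sum, map_smul]

/-- Expanding the moving argument in the fixed monomial basis separates its variation from that of
M. -/
theorem contDiffAt_substOmega_apply {M : E → Matrix (Fin (2 * n)) (Fin (2 * n)) ℂ}
    {v : E → Grass n} (hM : ContDiffAt ℂ m M x) (hv : ContDiffAt ℂ m v x) :
    ContDiffAt ℂ m (fun y => substOmega (M y) (v y)) x := by
  simp only [fun y => substOmega_eq_sum (M y) (v y)]
  exact ContDiffAt.sum fun I _ =>
    ((grassCoord n I).contDiff.comp_contDiffAt x hv).smul (contDiffAt_substOmega hM _)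

end Smooth

/-! ### Velocity of a moving substitution -/

section Deriv

variable {n : ℕ}

theorem hasDerivAt_grass_mul {u v : ℂ → Grass n} {u' v' : Grass n} {t : ℂ}
    (hu : HasDerivAt u u' t) (hv : HasDerivAt v v' t) :
    HasDerivAt (fun t => u t * v t) (u' * v t + u t * v') t := by
  have := (mulGrass n).hasDerivAt_of_bilinear (fun _ => hu) (fun _ => hv)
  simpa only [mulGrass_apply, add_comm] using this

theorem hasDerivAt_matrix {p q : Type*} [Fintype p] [Fintype q] {M : ℂ → Matrix p q ℂ}
    {M' : Matrix p q ℂ} {t : ℂ} :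
    HasDerivAt M M' t ↔ ∀ i j, HasDerivAt (fun t => M t i j) (M' i j) t := by
  constructor
  · intro h i j
    exact hasDerivAt_pi.1 (hasDerivAt_pi.1 h i) j
  · intro h
    exact hasDerivAt_pi.2 fun i => hasDerivAt_pi.2 fun j => h i j

theorem hasDerivAt_mulVec {p q : Type*} [Fintype p] [Fintype q] {M : ℂ → Matrix p q ℂ}
    {M' : Matrix p q ℂ} {t : ℂ} (hM : HasDerivAt M M' t) (w : q → ℂ) :
    HasDerivAt (fun t => M t *ᵥ w) (M' *ᵥ w) t := by
  refine hasDerivAt_pi.2 fun i => ?_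
  simp only [Matrix.mulVec, dotProduct]
  exact HasDerivAt.fun_sum fun j _ => (hasDerivAt_matrix.1 hM i j).mul_const _

theorem differentiableAt_substOmega {M : ℂ → Matrix (Fin (2 * n)) (Fin (2 * n)) ℂ}
    {M' : Matrix (Fin (2 * n)) (Fin (2 * n)) ℂ} {t : ℂ} (hM : HasDerivAt M M' t) (v : Grass n) :
    DifferentiableAt ℂ (fun t => substOmega (M t) v) t := by
  induction v using ExteriorAlgebra.induction with
  | algebraMap r => simp only [AlgHom.commutes]; fun_prop
  | ι w =>
    simp only [← iota_apply, substOmega_iota]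
    exact (iota n).differentiableAt.comp t (hasDerivAt_mulVec hM w).differentiableAt
  | mul a b ha hb =>
    simpa only [map_mul] using (hasDerivAt_grass_mul ha.hasDerivAt hb.hasDerivAt).differentiableAt
  | add a b ha hb => simpa only [map_add] using ha.fun_add hb

/-- The contribution of M stays an unevaluated `deriv` with frozen argument, the shape that
`sum_omega_mul_deriv_substOmega` evaluates after contraction with ω^A. -/
theorem hasDerivAt_substOmega_apply {M : ℂ → Matrix (Fin (2 * n)) (Fin (2 * n)) ℂ}
    {M' : Matrix (Fin (2 * n)) (Fin (2 * n)) ℂ} {t : ℂ} (hM : HasDerivAt M M' t)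
    {v : ℂ → Grass n} {v' : Grass n} (hv : HasDerivAt v v' t) :
    HasDerivAt (fun t => substOmega (M t) (v t))
      (deriv (fun r => substOmega (M r) (v t)) t + substOmega (M t) v') t := by
  have hd := fun w => (differentiableAt_substOmega hM w).hasDerivAt
  have h1 : HasDerivAt (fun r => substOmega (M r) (v t))
      (∑ I, grassCoord n I (v t) • deriv (fun r => substOmega (M r) (grassBasis n I)) t) t := by
    simp only [fun r => substOmega_eq_sum (M r) (v t)]
    exact HasDerivAt.fun_sum fun I _ => (hd _).fun_const_smul _
  have h2 : HasDerivAt (fun t => substOmega (M t) (v t))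
      (∑ I, (grassCoord n I (v t) • deriv (fun r => substOmega (M r) (grassBasis n I)) t +
        grassCoord n I v' • substOmega (M t) (grassBasis n I))) t := by
    simp only [fun r => substOmega_eq_sum (M r) (v r)]
    exact HasDerivAt.fun_sum fun I _ =>
      ((grassCoord n I).hasFDerivAt.comp_hasDerivAt t hv).fun_smul (hd _)
  rw [h1.deriv, substOmega_eq_sum (M t) v', ← Finset.sum_add_distrib]
  exact h2

/-- If `M_A` has velocity `x ↦ -(M x)_A γ`, then `ω^A` contracted with the velocity of the
substitution `M_A` is multiplication by `τ γ` on elements of degree `τ`. -/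
theorem sum_omega_mul_deriv_substOmega {τ : ℕ}
    {M : Fin (2 * n) → ℂ → Matrix (Fin (2 * n)) (Fin (2 * n)) ℂ}
    {M₀ : Matrix (Fin (2 * n)) (Fin (2 * n)) ℂ}
    {M' : Fin (2 * n) → Matrix (Fin (2 * n)) (Fin (2 * n)) ℂ} {γ : Fin (2 * n) → ℂ}
    (h0 : ∀ A, M A 0 = M₀) (hM : ∀ A, HasDerivAt (M A) (M' A) 0)
    (hγ : ∀ A x, M' A *ᵥ x = -((M₀ *ᵥ x) A) • γ) {v : Grass n}
    (hv : v ∈ (⋀[ℂ]^τ (Fin (2 * n) → ℂ))) :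
    ∑ A, omega A * deriv (fun t => substOmega (M A t) v) 0 =
      (τ : ℂ) • (iota n γ * substOmega M₀ v) := by
  have hd := fun A w => differentiableAt_substOmega (hM A) w
  induction hv using Submodule.pow_induction_on_left' with
  | algebraMap r => simp
  | add x y i hx hy ihx ihy =>
    simp only [map_add]
    simp only [fun A => deriv_fun_add (hd A x) (hd A y), mul_add, Finset.sum_add_distrib, ihx, ihy,
      smul_add]
  | mem_mul m hm i x hx ih =>
    obtain ⟨w, rfl⟩ := hm
    have hw : ∀ A, HasDerivAt (fun t => substOmega (M A t) (ExteriorAlgebra.ι ℂ w))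
        (-((M₀ *ᵥ w) A) • iota n γ) 0 := by
      intro A
      simp only [← iota_apply, substOmega_iota]
      rw [← map_smul, ← hγ]
      exact (iota n).hasFDerivAt.comp_hasDerivAt 0 (hasDerivAt_mulVec (hM A) w)
    simp only [map_mul, fun A => (hasDerivAt_grass_mul (hw A) (hd A x).hasDerivAt).deriv, h0]
    -- Product rule on w · x. In the second term ω^A is moved past M₀ w at the cost of a sign, so
    -- that the induction hypothesis applies to what remains.
    have e : ∀ A, omega A * (-((M₀ *ᵥ w) A) • iota n γ * substOmega M₀ x +
        substOmega M₀ (ExteriorAlgebra.ι ℂ w) * deriv (fun t => substOmega (M A t) x) 0) =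
        -((((M₀ *ᵥ w) A) • omega A) * (iota n γ * substOmega M₀ x)) -
        iota n (M₀ *ᵥ w) * (omega A * deriv (fun t => substOmega (M A t) x) 0) := by
      intro A
      rw [← iota_apply, substOmega_iota, mul_add, ← mul_assoc (omega A) (iota n _), omega,
        ← iota_apply, iota_mul_iota]
      simp only [neg_smul, neg_mul, mul_neg, smul_mul_assoc, mul_smul_comm, mul_assoc]
      abel
    simp only [e, Finset.sum_sub_distrib, Finset.sum_neg_distrib, ← Finset.sum_mul,
      ← Finset.mul_sum, ← iota_eq_sum, ih]
    -- Both terms now begin with -(M₀ w) γ = γ (M₀ w); their coefficients 1 and i add up to the new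
    -- degree.
    have h := congrArg (· * substOmega M₀ x) (iota_mul_iota (M₀ *ᵥ w) γ)
    simp only [neg_mul, mul_assoc] at h
    rw [← iota_apply, substOmega_iota, mul_smul_comm, h]
    push_cast
    module

end Deriv

/-! ### Homogeneous polynomials and sections -/

section Fiber

variable {n σ τ : ℕ} {p q : (Fin 2 → ℂ) → Grass n}

theorem fiber_zero : (fun _ => 0 : (Fin 2 → ℂ) → Grass n) ∈ fiber n σ τ :=
  ⟨0, fun _ => Submodule.zero_mem _, fun s => by simp⟩

theorem fiber_add (hp : p ∈ fiber n σ τ) (hq : q ∈ fiber n σ τ) :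
    (fun s => p s + q s) ∈ fiber n σ τ := by
  obtain ⟨c, hc, hp⟩ := hp
  obtain ⟨d, hd, hq⟩ := hq
  exact ⟨c + d, fun i => Submodule.add_mem _ (hc i) (hd i), fun s => by
    simp [hp, hq, smul_add, Finset.sum_add_distrib]⟩

theorem fiber_sum {I : Type*} (u : Finset I) {p : I → (Fin 2 → ℂ) → Grass n}
    (hp : ∀ i ∈ u, p i ∈ fiber n σ τ) : (fun s => ∑ i ∈ u, p i s) ∈ fiber n σ τ := by
  classical
  induction u using Finset.induction_on with
  | empty => simpa using fiber_zero
  | insert a u ha ih =>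
    simp only [Finset.sum_insert ha]
    exact fiber_add (hp a (by simp)) (ih fun i hi => hp i (by simp [hi]))

theorem fiber_map {τ' : ℕ} (T : Grass n →ₗ[ℂ] Grass n)
    (hT : ∀ v ∈ (⋀[ℂ]^τ (Fin (2 * n) → ℂ)), T v ∈ (⋀[ℂ]^τ' (Fin (2 * n) → ℂ)))
    (hp : p ∈ fiber n σ τ) : (fun s => T (p s)) ∈ fiber n σ τ' := by
  obtain ⟨c, hc, hp⟩ := hp
  exact ⟨fun i => T (c i), fun i => hT _ (hc i), fun s => by simp [hp]⟩

theorem fiber_smul (a : ℂ) (hp : p ∈ fiber n σ τ) : (fun s => a • p s) ∈ fiber n σ τ :=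
  fiber_map (a • LinearMap.id) (fun _ hv => Submodule.smul_mem _ a hv) hp

theorem fiber_monomial {c : Grass n} (hc : c ∈ (⋀[ℂ]^τ (Fin (2 * n) → ℂ))) {a b : ℕ}
    (hab : a + b = σ) : (fun s : Fin 2 → ℂ => (s 0 ^ a * s 1 ^ b) • c) ∈ fiber n σ τ := by
  refine ⟨Pi.single ⟨a, by omega⟩ c, fun i => ?_, fun s => ?_⟩
  · by_cases h : i = ⟨a, by omega⟩
    · subst h; simpa using hc
    · simp [Pi.single_eq_of_ne h]
  · rw [Finset.sum_eq_single ⟨a, by omega⟩]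
    · simp [← hab]
    · intro i _ h
      simp [Pi.single_eq_of_ne h]
    · simp

theorem fiber_coord_smul (B : Fin 2) (hp : p ∈ fiber n σ τ) :
    (fun s => s B • p s) ∈ fiber n (σ + 1) τ := by
  obtain ⟨c, hc, hp⟩ := hp
  simp only [hp, Finset.smul_sum, smul_smul]
  refine fiber_sum _ fun i _ => ?_
  have hi := i.2
  fin_cases B
  · convert fiber_monomial (σ := σ + 1) (hc i) (a := i + 1) (b := σ - i) (by omega) using 3
    simp; ring
  · convert fiber_monomial (σ := σ + 1) (hc i) (a := i) (b := σ - i + 1) (by omega) using 3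
    simp; ring

theorem fiber_linear_smul (a : Fin 2 → ℂ) (hp : p ∈ fiber n σ τ) :
    (fun s => (∑ B, a B * s B) • p s) ∈ fiber n (σ + 1) τ := by
  simp only [Finset.sum_smul, mul_smul]
  exact fiber_sum _ fun B _ => fiber_smul _ (fiber_coord_smul B hp)

theorem fiber_linear_pow_smul (a : Fin 2 → ℂ) (m : ℕ) (hp : p ∈ fiber n σ τ) :
    (fun s => (∑ B, a B * s B) ^ m • p s) ∈ fiber n (σ + m) τ := by
  induction m with
  | zero => simpa using hp
  | succ m ih => simpa only [pow_succ', mul_smul, ← add_assoc] using fiber_linear_smul a ih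

theorem fiber_const {c : Grass n} (hc : c ∈ (⋀[ℂ]^τ (Fin (2 * n) → ℂ))) :
    (fun _ => c) ∈ fiber n 0 τ :=
  ⟨fun _ => c, fun _ => hc, fun s => by simp⟩

/-- Each monomial becomes a product of powers of two linear forms, built up from its constant
coefficient one linear factor at a time. -/
theorem fiber_substS (M : Matrix (Fin 2) (Fin 2) ℂ) (hp : p ∈ fiber n σ τ) :
    substS M p ∈ fiber n σ τ := by
  obtain ⟨c, hc, hp⟩ := hp
  have e : substS M p = fun s => _ := funext fun s => hp _
  rw [e]
  refine fiber_sum _ fun i _ => ?_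
  have hi : 0 + (σ - (i : ℕ)) + i = σ := by have := i.2; omega
  have := fiber_linear_pow_smul (fun B => M B 0) i
    (fiber_linear_pow_smul (fun B => M B 1) (σ - i) (fiber_const (hc i)))
  rw [hi] at this
  simpa only [mul_smul] using this

theorem fiber_contDiff (hp : p ∈ fiber n σ τ) {m : ℕ∞ω} : ContDiff ℂ m p := by
  obtain ⟨c, hc, hp⟩ := hp
  rw [funext hp]
  fun_prop

theorem fiber_mem (hp : p ∈ fiber n σ τ) (s : Fin 2 → ℂ) :
    p s ∈ (⋀[ℂ]^τ (Fin (2 * n) → ℂ)) := by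
  obtain ⟨c, hc, hp⟩ := hp
  rw [hp]
  exact Submodule.sum_mem _ fun i _ => Submodule.smul_mem _ _ (hc i)

theorem fiber_degree_zero (hp : p ∈ fiber n 0 τ) (s t : Fin 2 → ℂ) : p s = p t := by
  obtain ⟨c, hc, hp⟩ := hp
  simp [hp]

end Fiber

/-! ### Holomorphic coefficients of sections, and their derivatives -/

section Sections

variable {n σ τ : ℕ} {U : Set (Z n)} {f : SuperFun n}

/-- A section is polynomial in s for each z and holomorphic in z for each s. Interpolation writes
its coefficients as fixed linear combinations of finitely many values, hence they are holomorphic.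
-/
theorem sections_coefficients (hf : f ∈ Sections n σ τ U) :
    ∃ c : Fin (σ + 1) → Z n → Grass n, (∀ i, AnalyticOnNhd ℂ (c i) U) ∧
      (∀ i, ∀ z ∈ U, c i z ∈ (⋀[ℂ]^τ (Fin (2 * n) → ℂ))) ∧
      ∀ z ∈ U, ∀ s, f z s =
        ∑ i : Fin (σ + 1), (s 0 ^ (i : ℕ) * s 1 ^ (σ - (i : ℕ))) • c i z := by
  -- Nodes 0, …, σ on the line where the second variable is 1; being distinct, they give an
  -- invertible Vandermonde matrix.
  let v : Fin (σ + 1) → ℂ := fun i => (i : ℕ)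
  have hV : IsUnit (Matrix.vandermonde v).det := by
    rw [isUnit_iff_ne_zero, Matrix.det_vandermonde_ne_zero_iff]
    intro i j h
    exact Fin.ext (Nat.cast_injective (R := ℂ) h)
  let W := (Matrix.vandermonde v)⁻¹
  have key : ∀ z ∈ U, ∀ c : Fin (σ + 1) → Grass n,
      (∀ s, f z s = ∑ i : Fin (σ + 1), (s 0 ^ (i : ℕ) * s 1 ^ (σ - (i : ℕ))) • c i) →
      ∀ i, ∑ l, W i l • f z ![v l, 1] = c i := by
    intro z _ c hc i
    simp only [hc, Finset.smul_sum, smul_smul]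
    rw [Finset.sum_comm]
    simp only [← Finset.sum_smul]
    have e : ∀ y : Fin (σ + 1), ∑ l, W i l * ((![v l, 1] : Fin 2 → ℂ) 0 ^ (y : ℕ) *
        (![v l, 1] : Fin 2 → ℂ) 1 ^ (σ - (y : ℕ))) = (1 : Matrix (Fin (σ + 1)) (Fin (σ + 1)) ℂ) i y := by
      intro y
      rw [← Matrix.nonsing_inv_mul _ hV, Matrix.mul_apply]
      simp [W, Matrix.vandermonde_apply]
    simp only [e]
    simp [Matrix.one_apply]
  refine ⟨fun i z => ∑ l, W i l • f z ![v l, 1], fun i => ?_, fun i z hz => ?_, fun z hz s => ?_⟩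
  · exact Finset.analyticOnNhd_fun_sum _ fun l _ => fun z hz => analyticAt_const.fun_smul (hf.2 _ z hz)
  · obtain ⟨c, hc, hp⟩ := hf.1 z hz
    simp only [key z hz c hp]
    exact hc i
  · obtain ⟨c, hc, hp⟩ := hf.1 z hz
    simp only [key z hz c hp]
    exact hp s

theorem sections_contDiff (hf : f ∈ Sections n σ τ Set.univ) {m : ℕ∞ω} :
    ContDiff ℂ m (fun q : Z n × (Fin 2 → ℂ) => f q.1 q.2) := by
  obtain ⟨c, hc, -, hp⟩ := sections_coefficients hf
  have e : (fun q : Z n × (Fin 2 → ℂ) => f q.1 q.2) = fun q => ∑ i : Fin (σ + 1),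
      (q.2 0 ^ (i : ℕ) * q.2 1 ^ (σ - (i : ℕ))) • c i q.1 := funext fun q => hp _ trivial _
  have hcd : ∀ i, ContDiff ℂ m (c i) := fun i =>
    contDiff_iff_contDiffAt.2 fun z => (hc i z trivial).contDiffAt
  rw [e]
  fun_prop

theorem sections_sum {I : Type*} (u : Finset I) {f : I → SuperFun n}
    (hf : ∀ i ∈ u, f i ∈ Sections n σ τ U) :
    (fun z s => ∑ i ∈ u, f i z s) ∈ Sections n σ τ U :=
  ⟨fun z hz => fiber_sum u fun i hi => (hf i hi).1 z hz,
    fun s => Finset.analyticOnNhd_fun_sum _ fun i hi => (hf i hi).2 s⟩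

theorem sections_smul (a : ℂ) (hf : f ∈ Sections n σ τ U) :
    (fun z s => a • f z s) ∈ Sections n σ τ U :=
  ⟨fun z hz => fiber_smul a (hf.1 z hz), fun s z hz => analyticAt_const.fun_smul (hf.2 s z hz)⟩

theorem sections_linear_smul (a : Fin 2 → ℂ) (hf : f ∈ Sections n σ τ U) :
    (fun z s => (∑ B, a B * s B) • f z s) ∈ Sections n (σ + 1) τ U :=
  ⟨fun z hz => fiber_linear_smul a (hf.1 z hz), fun s z hz => analyticAt_const.fun_smul (hf.2 s z hz)⟩

theorem sections_iota_mul (x : Fin (2 * n) → ℂ) (hf : f ∈ Sections n σ τ U) :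
    (fun z s => iota n x * f z s) ∈ Sections n σ (τ + 1) U :=
  ⟨fun z hz => fiber_map (LinearMap.mulLeft ℂ (iota n x)) (fun _ hv => iota_mul_mem x hv)
    (hf.1 z hz), fun s => ((mulGrass n (iota n x)).analyticOnNhd Set.univ).comp (hf.2 s)
      fun _ _ => trivial⟩

/-- A derivative lies in the closure of the span of the values, and a finite-dimensional subspace is
closed. -/
theorem deriv_mem_exteriorPower {u : ℂ → Grass n}
    (hu : ∀ t, u t ∈ (⋀[ℂ]^τ (Fin (2 * n) → ℂ))) (t : ℂ) :
    deriv u t ∈ (⋀[ℂ]^τ (Fin (2 * n) → ℂ)) := by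
  have h := range_deriv_subset_closure_span_image u dense_univ (Set.mem_range_self t)
  refine closure_minimal ?_ (Submodule.closed_of_finiteDimensional _) h
  refine Submodule.span_le.2 ?_
  rintro _ ⟨t, -, rfl⟩
  exact hu t

theorem dz_eq_fderiv {f : SuperFun n} {z : Z n} {s : Fin 2 → ℂ}
    (hf : DifferentiableAt ℂ (fun z => f z s) z) (A : Fin (2 * n)) (A' : Fin 2) :
    dz A A' f z s = fderiv ℂ (fun z => f z s) z (Matrix.single A A' 1) := by
  have h : HasDerivAt (fun t : ℂ => z + t • (Matrix.single A A' 1 : Z n))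
      (Matrix.single A A' 1) 0 := by
    have := ((hasDerivAt_id (0 : ℂ)).smul_const (Matrix.single A A' 1 : Z n)).const_add z
    rwa [one_smul] at this
  have h2 : HasFDerivAt (fun z => f z s) (fderiv ℂ (fun z => f z s) z)
    (z + (0 : ℂ) • (Matrix.single A A' 1 : Z n)) := by simpa using hf.hasFDerivAt
  exact (h2.comp_hasDerivAt (0 : ℂ) h).deriv

theorem sections_dz (A : Fin (2 * n)) (A' : Fin 2) (hf : f ∈ Sections n σ τ Set.univ) :
    dz A A' f ∈ Sections n σ τ Set.univ := by
  constructor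
  · intro z _
    obtain ⟨c, hc, hm, hp⟩ := sections_coefficients hf
    have hp' : ∀ z s, f z s = _ := fun z => hp z trivial
    refine ⟨fun i => deriv (fun t : ℂ => c i (z + t • Matrix.single A A' 1)) 0,
      fun i => deriv_mem_exteriorPower (fun t => hm i _ trivial) 0, fun s => ?_⟩
    have hd : ∀ i, DifferentiableAt ℂ (fun t : ℂ => c i (z + t • Matrix.single A A' 1)) 0 := by
      intro i
      refine DifferentiableAt.comp (0 : ℂ) (hc i _ trivial).differentiableAt ?_
      fun_prop
    simp only [dz, hp']
    exact (HasDerivAt.fun_sum fun i _ => (hd i).hasDerivAt.fun_const_smul _).deriv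
  · intro s
    have e : (fun z => dz A A' f z s) =
        fun z => fderiv ℂ (fun z => f z s) z (Matrix.single A A' 1) :=
      funext fun z => dz_eq_fderiv (hf.2 s z trivial).differentiableAt A A'
    rw [e]
    exact fun z _ => ((ContinuousLinearMap.apply ℂ (Grass n)
      (Matrix.single A A' 1 : Z n)).analyticAt _).comp (hf.2 s z trivial).fderiv

theorem omega_eq_iota (A : Fin (2 * n)) : omega A = iota n (Pi.single A 1) := rfl

theorem sections_dTilde (A' : Fin 2) (hf : f ∈ Sections n σ τ Set.univ) :
    dTilde A' f ∈ Sections n σ (τ + 1) Set.univ :=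
  sections_sum _ fun A _ => sections_iota_mul (Pi.single A 1) (sections_dz A A' hf)

theorem sections_ds (A' : Fin 2) (hf : f ∈ Sections n (σ + 1) τ Set.univ) :
    ds A' f ∈ Sections n σ τ Set.univ := by
  obtain ⟨c, hc, hm, hp⟩ := sections_coefficients hf
  have hp' : ∀ z s, f z s = _ := fun z => hp z trivial
  obtain ⟨q, hq, hq'⟩ : ∃ q : Fin (σ + 1 + 1) → (Fin 2 → ℂ) → ℂ,
      (∀ i, ∀ v ∈ (⋀[ℂ]^τ (Fin (2 * n) → ℂ)), (fun s => q i s • v) ∈ fiber n σ τ) ∧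
      ∀ (i : Fin (σ + 1 + 1)) (s : Fin 2 → ℂ), HasDerivAt (fun t : ℂ =>
        (s + t • Pi.single A' 1 : Fin 2 → ℂ) 0 ^ (i : ℕ) *
        (s + t • Pi.single A' 1 : Fin 2 → ℂ) 1 ^ (σ + 1 - (i : ℕ))) (q i s) 0 := by
    fin_cases A'
    · refine ⟨fun i s => i * (s 0 ^ ((i : ℕ) - 1) * s 1 ^ (σ + 1 - (i : ℕ))), fun i v hv => ?_,
        fun i s => ?_⟩
      -- At i = 0 the truncated exponent i - 1 gives the wrong degree, but the prefactor i vanishes.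
      · rcases Nat.eq_zero_or_pos (i : ℕ) with h | h
        · simpa [h] using fiber_zero
        · simp only [mul_smul _ (_ * _)]
          have := i.2
          exact fiber_smul _ (fiber_monomial hv (by omega))
      · have h := ((((hasDerivAt_id (0 : ℂ)).const_add (s 0)).pow (i : ℕ)).mul_const
          (s 1 ^ (σ + 1 - (i : ℕ))))
        simpa [mul_assoc] using h
    · refine ⟨fun i s => (σ + 1 - (i : ℕ) : ℕ) *
        (s 0 ^ (i : ℕ) * s 1 ^ (σ + 1 - (i : ℕ) - 1)), fun i v hv => ?_, fun i s => ?_⟩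
      · rcases Nat.eq_zero_or_pos (σ + 1 - (i : ℕ)) with h | h
        · simpa [h] using fiber_zero
        · simp only [mul_smul _ (_ * _)]
          have := i.2
          exact fiber_smul _ (fiber_monomial hv (by omega))
      · have h := ((((hasDerivAt_id (0 : ℂ)).const_add (s 1)).pow (σ + 1 - (i : ℕ))).const_mul
          (s 0 ^ (i : ℕ)))
        simpa [mul_assoc, mul_left_comm] using h
  have e : ∀ z s, ds A' f z s = ∑ i, q i s • c i z := by
    intro z s
    simp only [ds, hp']
    exact (HasDerivAt.fun_sum fun i _ => (hq' i s).smul_const (c i z)).deriv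
  constructor
  · intro z hz
    rw [funext (e z)]
    exact fiber_sum _ fun i _ => hq i _ (hm i z hz)
  · intro s
    simp only [e]
    exact Finset.analyticOnNhd_fun_sum _ fun i _ z hz =>
      analyticAt_const.fun_smul (hc i z hz)

end Sections

/-! ### Derivatives of the fractional linear transformation -/

section MatrixCalculus

theorem hasDerivAt_matrix_mul {p q r : Type*} [Fintype p] [Fintype q] [Fintype r]
    {M : ℂ → Matrix p q ℂ} {N : ℂ → Matrix q r ℂ} {M' : Matrix p q ℂ} {N' : Matrix q r ℂ} {t : ℂ}
    (hM : HasDerivAt M M' t) (hN : HasDerivAt N N' t) :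
    HasDerivAt (fun t => M t * N t) (M' * N t + M t * N') t := by
  refine hasDerivAt_matrix.2 fun i j => ?_
  simp only [Matrix.mul_apply, Matrix.add_apply, ← Finset.sum_add_distrib]
  exact HasDerivAt.fun_sum fun l _ => (hasDerivAt_matrix.1 hM i l).mul (hasDerivAt_matrix.1 hN l j)

variable {E : Type*} [NormedAddCommGroup E] [NormedSpace ℂ E] {m : ℕ∞ω} {x : E}

theorem contDiffAt_matrix_mul {p q r : Type*} [Fintype p] [Fintype q] [Fintype r]
    {M : E → Matrix p q ℂ} {N : E → Matrix q r ℂ}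
    (hM : ContDiffAt ℂ m M x) (hN : ContDiffAt ℂ m N x) :
    ContDiffAt ℂ m (fun y => M y * N y) x := by
  refine contDiffAt_matrix.2 fun i j => ?_
  simp only [Matrix.mul_apply]
  exact ContDiffAt.sum fun l _ => (contDiffAt_matrix.1 hM i l).mul (contDiffAt_matrix.1 hN l j)

theorem contDiffAt_det_fin_two {M : E → Matrix (Fin 2) (Fin 2) ℂ} (hM : ContDiffAt ℂ m M x) :
    ContDiffAt ℂ m (fun y => (M y).det) x := by
  have h := contDiffAt_matrix.1 hM
  simp only [Matrix.det_fin_two]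
  exact ((h 0 0).mul (h 1 1)).sub ((h 0 1).mul (h 1 0))

theorem contDiffAt_inv_fin_two {M : E → Matrix (Fin 2) (Fin 2) ℂ} (hM : ContDiffAt ℂ m M x)
    (hx : (M x).det ≠ 0) : ContDiffAt ℂ m (fun y => (M y)⁻¹) x := by
  have h := contDiffAt_matrix.1 hM
  have hd := (contDiffAt_det_fin_two hM).inv hx
  refine contDiffAt_matrix.2 fun i j => ?_
  simp only [Matrix.inv_def, Ring.inverse_eq_inv', Matrix.smul_apply, smul_eq_mul]
  refine hd.mul ?_
  fin_cases i <;> fin_cases j <;> simp [Matrix.adjugate_fin_two]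
  exacts [h 1 1, (h 0 1).neg, (h 1 0).neg, h 0 0]

/-- The adjugate formula gives differentiability; differentiating M M⁻¹ = 1 then identifies the
derivative. -/
theorem hasDerivAt_inv_fin_two {M : ℂ → Matrix (Fin 2) (Fin 2) ℂ} {M' : Matrix (Fin 2) (Fin 2) ℂ}
    {t : ℂ} (hM : HasDerivAt M M' t) (hc : ContDiffAt ℂ 1 M t) (ht : (M t).det ≠ 0) :
    HasDerivAt (fun t => (M t)⁻¹) (-((M t)⁻¹ * M' * (M t)⁻¹)) t := by
  have hi := ((contDiffAt_inv_fin_two hc ht).differentiableAt one_ne_zero).hasDerivAt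
  have hu := (isUnit_iff_ne_zero.2 ht)
  have h1 := hasDerivAt_matrix_mul hM hi
  have h2 : HasDerivAt (fun t => M t * (M t)⁻¹) 0 t := by
    refine (hasDerivAt_const t (1 : Matrix (Fin 2) (Fin 2) ℂ)).congr_of_eventuallyEq ?_
    have hdet := (contDiffAt_det_fin_two hc).continuousAt.eventually_ne ht
    filter_upwards [hdet] with r hr
    exact Matrix.mul_nonsing_inv _ (isUnit_iff_ne_zero.2 hr)
  have h3 := congrArg ((M t)⁻¹ * ·) (h1.unique h2)
  simp only [mul_add, mul_zero, ← mul_assoc, Matrix.nonsing_inv_mul _ hu, one_mul] at h3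
  rwa [eq_neg_of_add_eq_zero_right h3] at hi

theorem hasDerivAt_det_fin_two {M : ℂ → Matrix (Fin 2) (Fin 2) ℂ} {M' : Matrix (Fin 2) (Fin 2) ℂ}
    {t : ℂ} (hM : HasDerivAt M M' t) (ht : (M t).det ≠ 0) :
    HasDerivAt (fun t => (M t).det) ((M t).det * ((M t)⁻¹ * M').trace) t := by
  have h := hasDerivAt_matrix.1 hM
  have h1 := ((h 0 0).fun_mul (h 1 1)).fun_sub ((h 0 1).fun_mul (h 1 0))
  have e : (M t).det * ((M t)⁻¹ * M').trace = ((M t).adjugate * M').trace := by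
    rw [Matrix.inv_def, Ring.inverse_eq_inv', Matrix.smul_mul, Matrix.trace_smul, smul_eq_mul,
      mul_inv_cancel_left₀ ht]
  rw [e]
  simp only [Matrix.det_fin_two]
  refine h1.congr_deriv ?_
  simp only [Matrix.trace_fin_two, Matrix.mul_apply, Fin.sum_univ_two, Matrix.adjugate_fin_two]
  simp
  ring

end MatrixCalculus

/-! ### Jacobians of the fractional linear action and the first-order formula -/

section Geometry

variable {n : ℕ} {h : BlockMat n} {z : Z n}

theorem contDiff_J₁ {m : ℕ∞ω} : ContDiff ℂ m (J₁ h) := by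
  refine contDiff_const.add (contDiff_iff_contDiffAt.2 fun z => ?_)
  exact contDiffAt_matrix_mul contDiffAt_const contDiffAt_id

theorem contDiffAt_J₁_inv {m : ℕ∞ω} (hz : (J₁ h z).det ≠ 0) :
    ContDiffAt ℂ m (fun z => (J₁ h z)⁻¹) z :=
  contDiffAt_inv_fin_two contDiff_J₁.contDiffAt hz

theorem contDiffAt_frac {m : ℕ∞ω} (hz : (J₁ h z).det ≠ 0) : ContDiffAt ℂ m (frac h) z :=
  contDiffAt_matrix_mul
    (contDiffAt_const.add (contDiffAt_matrix_mul contDiffAt_const contDiffAt_id))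
    (contDiffAt_J₁_inv hz)

theorem J₂_eq (h : BlockMat n) (z : Z n) :
    J₂ h z = h.toBlocks₂₂ - frac h z * h.toBlocks₁₂ := rfl

theorem contDiffAt_J₂_transpose {m : ℕ∞ω} (hz : (J₁ h z).det ≠ 0) :
    ContDiffAt ℂ m (fun z => (J₂ h z)ᵀ) z := by
  have h2 : ContDiffAt ℂ m (J₂ h) z :=
    contDiffAt_const.sub (contDiffAt_matrix_mul (contDiffAt_frac hz) contDiffAt_const)
  exact contDiffAt_matrix.2 fun i j => contDiffAt_matrix.1 h2 j i

theorem hasDerivAt_line (z E : Z n) : HasDerivAt (fun t : ℂ => z + t • E) E 0 := by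
  have := ((hasDerivAt_id (0 : ℂ)).smul_const E).const_add z
  rwa [one_smul] at this

theorem hasDerivAt_J₁ (z E : Z n) :
    HasDerivAt (fun t : ℂ => J₁ h (z + t • E)) (h.toBlocks₁₂ * E) 0 := by
  have := (hasDerivAt_matrix_mul (hasDerivAt_const (0 : ℂ) h.toBlocks₁₂)
    (hasDerivAt_line z E)).const_add h.toBlocks₁₁
  refine this.congr_deriv ?_
  rw [Matrix.zero_mul, zero_add]

theorem hasDerivAt_J₁_inv (hz : (J₁ h z).det ≠ 0) (E : Z n) :
    HasDerivAt (fun t : ℂ => (J₁ h (z + t • E))⁻¹)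
      (-((J₁ h z)⁻¹ * (h.toBlocks₁₂ * E) * (J₁ h z)⁻¹)) 0 := by
  have hc : ContDiff ℂ 1 (fun t : ℂ => J₁ h (z + t • E)) :=
    contDiff_J₁.comp (contDiff_const.add (contDiff_id.smul contDiff_const))
  have := hasDerivAt_inv_fin_two (hasDerivAt_J₁ z E) hc.contDiffAt (by simpa using hz)
  simpa only [zero_smul, add_zero] using this

/-- The quotient rule gives d E J₁⁻¹ - (h.z) b E J₁⁻¹, and d - (h.z) b is J₂. -/
theorem hasDerivAt_frac (hz : (J₁ h z).det ≠ 0) (E : Z n) :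
    HasDerivAt (fun t : ℂ => frac h (z + t • E)) (J₂ h z * E * (J₁ h z)⁻¹) 0 := by
  have hP := (hasDerivAt_matrix_mul (hasDerivAt_const (0 : ℂ) h.toBlocks₂₂)
    (hasDerivAt_line z E)).const_add h.toBlocks₂₁
  have := hasDerivAt_matrix_mul hP (hasDerivAt_J₁_inv hz E)
  refine this.congr_deriv ?_
  simp only [zero_smul, add_zero, Matrix.zero_mul, zero_add, J₂_eq, frac, Matrix.sub_mul,
    Matrix.mul_neg, Matrix.mul_assoc]
  simp only [sub_eq_add_neg]

theorem hasDerivAt_J₂_transpose (hz : (J₁ h z).det ≠ 0) (E : Z n) :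
    HasDerivAt (fun t : ℂ => (J₂ h (z + t • E))ᵀ)
      (-(J₂ h z * E * ((J₁ h z)⁻¹ * h.toBlocks₁₂)))ᵀ 0 := by
  have h1 : HasDerivAt (fun t : ℂ => J₂ h (z + t • E)) _ 0 :=
    (hasDerivAt_matrix_mul (hasDerivAt_frac hz E)
      (hasDerivAt_const (0 : ℂ) h.toBlocks₁₂)).const_sub h.toBlocks₂₂
  refine hasDerivAt_matrix.2 fun i j => ?_
  have := hasDerivAt_matrix.1 h1 j i
  refine HasDerivAt.congr_deriv this ?_
  simp only [Matrix.mul_zero, add_zero, Matrix.mul_assoc, Matrix.transpose_apply]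

theorem hasDerivAt_det_pow_inv (hz : (J₁ h z).det ≠ 0) (A : Fin (2 * n)) (A' : Fin 2) (m : ℕ) :
    HasDerivAt (fun t : ℂ => ((J₁ h (z + t • Matrix.single A A' 1)).det ^ m)⁻¹)
      (-(m * ((J₁ h z)⁻¹ * h.toBlocks₁₂) A' A * ((J₁ h z).det ^ m)⁻¹)) 0 := by
  have h1 := hasDerivAt_det_fin_two (hasDerivAt_J₁ (h := h) z (Matrix.single A A' 1))
    (by simpa using hz)
  have h2 := (h1.fun_pow m).fun_inv (by simpa using pow_ne_zero m hz)
  refine h2.congr_deriv ?_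
  simp only [zero_smul, add_zero, ← Matrix.mul_assoc, Matrix.trace_mul_single, MulOpposite.op_one, one_smul]
  -- The power rule involves m - 1, so m = 0 is separated.
  rcases m with _ | m
  · simp
  · simp only [Nat.add_sub_cancel]
    field_simp
    ring

theorem mul_single_mul_apply {p q r l : Type*} [Fintype q] [Fintype r] [DecidableEq q]
    [DecidableEq r] (M : Matrix p q ℂ) (N : Matrix r l ℂ) (A : q) (A' : r) (i : p) (j : l) :
    (M * (Matrix.single A A' 1 : Matrix q r ℂ) * N) i j = M i A * N A' j := by
  rw [Matrix.mul_assoc, Matrix.mul_apply, Finset.sum_eq_single A]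
  · simp [Matrix.single_mul_apply_same]
  · intro B _ hB
    simp [Matrix.single_mul_apply_of_ne _ _ _ _ _ hB]
  · simp

theorem dz_eq (f : SuperFun n) {s : Fin 2 → ℂ}
    (hf : DifferentiableAt ℂ (fun q : Z n × (Fin 2 → ℂ) => f q.1 q.2) (z, s))
    (A : Fin (2 * n)) (A' : Fin 2) :
    dz A A' f z s =
      fderiv ℂ (fun q : Z n × (Fin 2 → ℂ) => f q.1 q.2) (z, s) (Matrix.single A A' 1, 0) := by
  have h1 := (hasDerivAt_line z (Matrix.single A A' 1)).prodMk (hasDerivAt_const (0 : ℂ) s)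
  have h2 : HasFDerivAt (fun q : Z n × (Fin 2 → ℂ) => f q.1 q.2)
    (fderiv ℂ (fun q : Z n × (Fin 2 → ℂ) => f q.1 q.2) (z, s))
    (z + (0 : ℂ) • (Matrix.single A A' 1 : Z n), s) := by simpa using hf.hasFDerivAt
  exact (h2.comp_hasDerivAt (0 : ℂ) h1).deriv

theorem hasDerivAt_ds_line (s : Fin 2 → ℂ) (A' : Fin 2) :
    HasDerivAt (fun t : ℂ => s + t • (Pi.single A' 1 : Fin 2 → ℂ)) (Pi.single A' 1) 0 := by
  have := ((hasDerivAt_id (0 : ℂ)).smul_const (Pi.single A' 1 : Fin 2 → ℂ)).const_add s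
  rwa [one_smul] at this

theorem ds_eq (f : SuperFun n) {s : Fin 2 → ℂ}
    (hf : DifferentiableAt ℂ (fun q : Z n × (Fin 2 → ℂ) => f q.1 q.2) (z, s)) (A' : Fin 2) :
    ds A' f z s =
      fderiv ℂ (fun q : Z n × (Fin 2 → ℂ) => f q.1 q.2) (z, s) (0, Pi.single A' 1) := by
  have h1 := (hasDerivAt_const (0 : ℂ) z).prodMk (hasDerivAt_ds_line s A')
  have h2 : HasFDerivAt (fun q : Z n × (Fin 2 → ℂ) => f q.1 q.2)
    (fderiv ℂ (fun q : Z n × (Fin 2 → ℂ) => f q.1 q.2) (z, s))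
    (z, s + (0 : ℂ) • (Pi.single A' 1 : Fin 2 → ℂ)) := by simpa using hf.hasFDerivAt
  exact (h2.comp_hasDerivAt (0 : ℂ) h1).deriv

/-- The chain rule for functions in supervariables along a curve. -/
theorem hasDerivAt_superFun {f : SuperFun n} {w : ℂ → Z n} {σ : ℂ → Fin 2 → ℂ} {w' : Z n}
    {σ' : Fin 2 → ℂ} {t : ℂ} (hw : HasDerivAt w w' t) (hσ : HasDerivAt σ σ' t)
    (hf : DifferentiableAt ℂ (fun q : Z n × (Fin 2 → ℂ) => f q.1 q.2) (w t, σ t)) :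
    HasDerivAt (fun t => f (w t) (σ t))
      (∑ B', ∑ B, w' B B' • dz B B' f (w t) (σ t) + ∑ B', σ' B' • ds B' f (w t) (σ t)) t := by
  have h := hf.hasFDerivAt.comp_hasDerivAt t (hw.prodMk hσ)
  refine h.congr_deriv ?_
  simp only [dz_eq f hf, ds_eq f hf, ← map_smul, ← map_sum, ← map_add]
  congr 1
  ext i j
  · fin_cases j <;> simp [Prod.fst_sum, Matrix.sum_apply, Matrix.single_apply]
  · fin_cases i <;> simp [Prod.snd_sum]

/-- The function `det(a + bz)^{-m} f(h.z, σ(z))`, with `J₂ᵗ` acting on the `ω^A`. -/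
noncomputable def twist (h : BlockMat n) (m : ℕ) (σ : Z n → Fin 2 → ℂ) (f : SuperFun n) :
    Z n → Grass n := fun z =>
  ((J₁ h z).det ^ m)⁻¹ • substOmega (J₂ h z)ᵀ (f (frac h z) (σ z))

/-- The elements `β_{A'} = ((a + bz)⁻¹ b)_{A'A} ω^A`. -/
noncomputable def beta (h : BlockMat n) (z : Z n) (A' : Fin 2) : Grass n :=
  iota n (((J₁ h z)⁻¹ * h.toBlocks₁₂) A')

theorem contDiffAt_twist {m : ℕ∞ω} (hz : (J₁ h z).det ≠ 0) (p : ℕ) {σ : Z n → Fin 2 → ℂ}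
    (hσ : ContDiffAt ℂ m σ z) {f : SuperFun n}
    (hf : ContDiff ℂ m (fun q : Z n × (Fin 2 → ℂ) => f q.1 q.2)) :
    ContDiffAt ℂ m (twist h p σ f) z := by
  refine ContDiffAt.smul (((contDiffAt_det_fin_two contDiff_J₁.contDiffAt).pow p).inv
    (pow_ne_zero p hz)) (contDiffAt_substOmega_apply (contDiffAt_J₂_transpose hz) ?_)
  exact hf.contDiffAt.comp z ((contDiffAt_frac hz).prodMk hσ)

theorem substOmega_J₂_omega (B : Fin (2 * n)) :
    substOmega (J₂ h z)ᵀ (omega B) = ∑ A, J₂ h z B A • omega A :=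
  substOmega_omega _ _

/-- The operator `ω^A ∂_{AA'}` applied to a twisted function. -/
theorem sum_omega_mul_deriv_twist (hz : (J₁ h z).det ≠ 0) (m τ : ℕ) (A' : Fin 2)
    {σ : Z n → Fin 2 → ℂ} {σ' : Fin (2 * n) → Fin 2 → ℂ}
    (hσ : ∀ A, HasDerivAt (fun t : ℂ => σ (z + t • Matrix.single A A' 1)) (σ' A) 0)
    {f : SuperFun n} (hf : Differentiable ℂ (fun q : Z n × (Fin 2 → ℂ) => f q.1 q.2))
    (hτ : f (frac h z) (σ z) ∈ (⋀[ℂ]^τ (Fin (2 * n) → ℂ))) :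
    ∑ A, omega A * deriv (fun t : ℂ => twist h m σ f (z + t • Matrix.single A A' 1)) 0 =
      ((τ : ℂ) - m) • (beta h z A' * twist h m σ f z) +
      ∑ B', iota n (fun A => σ' A B') * twist h m σ (ds B' f) z +
      ∑ B', (J₁ h z)⁻¹ A' B' • twist h m σ (dTilde B' f) z := by
  set δ := ((J₁ h z).det ^ m)⁻¹ with hδ
  set M : Fin (2 * n) → ℂ → Matrix (Fin (2 * n)) (Fin (2 * n)) ℂ :=
    fun A t => (J₂ h (z + t • Matrix.single A A' 1))ᵀ with hM
  have hM0 : ∀ A, M A 0 = (J₂ h z)ᵀ := fun A => by simp [hM]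
  have hM' : ∀ A, HasDerivAt (M A) _ 0 := fun A => hasDerivAt_J₂_transpose hz (Matrix.single A A' 1)
  -- Along E_{AA'} the velocity of J₂ᵗ has rank at most one, with γ the row A' of Kb, so that γ
  -- becomes β_{A'} in the Grassmann algebra.
  have hγ : ∀ (A : Fin (2 * n)) (x : Fin (2 * n) → ℂ), (-(J₂ h z * (Matrix.single A A' 1 : Z n) *
      ((J₁ h z)⁻¹ * h.toBlocks₁₂)))ᵀ *ᵥ x =
      -(((J₂ h z)ᵀ *ᵥ x) A) • ((J₁ h z)⁻¹ * h.toBlocks₁₂) A' := by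
    intro A x
    ext C
    have e : ∀ B, (J₂ h z * (Matrix.single A A' 1 : Z n) *
        ((J₁ h z)⁻¹ * h.toBlocks₁₂)) B C = J₂ h z B A * ((J₁ h z)⁻¹ * h.toBlocks₁₂) A' C :=
      fun B => mul_single_mul_apply _ _ _ _ _ _
    simp only [Matrix.mulVec, dotProduct, Matrix.transpose_apply, Matrix.neg_apply, e,
      Pi.smul_apply, smul_eq_mul, neg_mul, Finset.sum_neg_distrib, Finset.sum_mul]
    exact congrArg _ (Finset.sum_congr rfl fun B _ => by ring)
  have hD := sum_omega_mul_deriv_substOmega hM0 hM' hγ hτ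
  set K' : Fin (2 * n) → Grass n := fun A =>
    ∑ B', ∑ B, (J₂ h z B A * (J₁ h z)⁻¹ A' B') • dz B B' f (frac h z) (σ z) +
      ∑ B', σ' A B' • ds B' f (frac h z) (σ z) with hK'
  have hK : ∀ A, HasDerivAt (fun t : ℂ => f (frac h (z + t • Matrix.single A A' 1))
      (σ (z + t • Matrix.single A A' 1))) (K' A) 0 := by
    intro A
    have := hasDerivAt_superFun (hasDerivAt_frac hz (Matrix.single A A' 1)) (hσ A) (hf _)
    simp only [zero_smul, add_zero] at this
    refine this.congr_deriv ?_
    simp only [hK', mul_single_mul_apply]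
  have hF : ∀ A, deriv (fun t : ℂ => twist h m σ f (z + t • Matrix.single A A' 1)) 0 =
      δ • (deriv (fun t => substOmega (M A t) (f (frac h z) (σ z))) 0 +
        substOmega (J₂ h z)ᵀ (K' A)) -
      (m * ((J₁ h z)⁻¹ * h.toBlocks₁₂) A' A) • twist h m σ f z := by
    intro A
    have := (hasDerivAt_det_pow_inv hz A A' m).fun_smul
      (hasDerivAt_substOmega_apply (hM' A) (hK A))
    refine this.deriv.trans ?_
    simp only [zero_smul, add_zero, hM0]
    rw [neg_smul, ← sub_eq_add_neg, twist, smul_smul]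
  -- The entries J₂_{BA} from the velocity of h.z combine with ω^A into the image of ω^B, which
  -- reassembles d_{B'} f inside the substitution.
  have hL : ∑ A, omega A * substOmega (J₂ h z)ᵀ (K' A) =
      ∑ B', iota n (fun A => σ' A B') * substOmega (J₂ h z)ᵀ (ds B' f (frac h z) (σ z)) +
      ∑ B', (J₁ h z)⁻¹ A' B' • substOmega (J₂ h z)ᵀ (dTilde B' f (frac h z) (σ z)) := by
    simp only [hK', map_add, mul_add, Finset.sum_add_distrib]
    rw [add_comm]
    congr 1
    · simp only [map_sum, map_smul, iota_eq_sum, Finset.sum_mul, Finset.mul_sum]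
      rw [Finset.sum_comm]
      simp only [mul_smul_comm, smul_mul_assoc]
    · simp only [dTilde, map_sum, map_mul, map_smul, Finset.mul_sum, substOmega_J₂_omega,
        Finset.sum_mul, Finset.smul_sum]
      rw [Finset.sum_comm]
      refine Finset.sum_congr rfl fun B' _ => ?_
      rw [Finset.sum_comm]
      refine Finset.sum_congr rfl fun B _ => Finset.sum_congr rfl fun A _ => ?_
      rw [mul_smul_comm, smul_mul_assoc, smul_smul]
      exact congrArg (· • _) (mul_comm _ _)
  have hβ : ∑ A, omega A * ((m * ((J₁ h z)⁻¹ * h.toBlocks₁₂) A' A) • twist h m σ f z) =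
      (m : ℂ) • (beta h z A' * twist h m σ f z) := by
    simp only [beta, iota_eq_sum, Finset.sum_mul, Finset.smul_sum, mul_smul_comm, smul_mul_assoc,
      smul_smul]
  have e : ∀ A, omega A * deriv (fun t : ℂ => twist h m σ f (z + t • Matrix.single A A' 1)) 0 =
      δ • (omega A * deriv (fun t => substOmega (M A t) (f (frac h z) (σ z))) 0) +
      δ • (omega A * substOmega (J₂ h z)ᵀ (K' A)) -
      omega A * ((m * ((J₁ h z)⁻¹ * h.toBlocks₁₂) A' A) • twist h m σ f z) := by
    intro A
    rw [hF, mul_sub, mul_smul_comm, mul_add, smul_add]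
  rw [Finset.sum_congr rfl fun A _ => e A, Finset.sum_sub_distrib, Finset.sum_add_distrib,
    ← Finset.smul_sum, ← Finset.smul_sum, hβ, hD, hL]
  have e1 : ∀ B', twist h m σ (ds B' f) z =
      δ • substOmega (J₂ h z)ᵀ (ds B' f (frac h z) (σ z)) := fun _ => rfl
  have e2 : ∀ B', twist h m σ (dTilde B' f) z =
      δ • substOmega (J₂ h z)ᵀ (dTilde B' f (frac h z) (σ z)) := fun _ => rfl
  have e3 : twist h m σ f z = δ • substOmega (J₂ h z)ᵀ (f (frac h z) (σ z)) := rfl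
  simp only [e1, e2, e3, beta, mul_smul_comm, smul_comm _ δ, ← Finset.smul_sum]
  module

end Geometry

/-! ### Mapping properties -/

section Mapping

variable {n : ℕ}

theorem sections_D {k j : ℕ} {f : SuperFun n} (hf : f ∈ Gam n k j Set.univ) :
    D k j f ∈ Gam n k (j + 1) Set.univ := by
  unfold Gam at hf ⊢
  rcases lt_trichotomy j k with h | h | h
  · have e1 : degS k j = degS k (j + 1) + 1 := by
      rw [degS, degS, if_pos h.le, if_pos (by omega)]; omega
    have e2 : degOmega k (j + 1) = degOmega k j + 1 := by
      rw [degOmega, degOmega, if_pos h.le, if_pos (by omega)]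
    rw [e1] at hf
    rw [e2, D, if_pos h]
    exact sections_sum _ fun A' _ => sections_sum _ fun B' _ =>
      sections_smul _ (sections_ds B' (sections_dTilde A' hf))
  · subst h
    have e1 : degS j (j + 1) = degS j j := by simp [degS]
    -- The Grassmann degree jumps by two here, matching the second-order operator.
    have e2 : degOmega j (j + 1) = degOmega j j + 1 + 1 := by simp [degOmega]
    rw [e1, e2, D, if_neg (lt_irrefl _), if_pos rfl]
    exact sections_dTilde 0 (sections_dTilde 1 hf)
  · have e1 : degS k (j + 1) = degS k j + 1 := by
      rw [degS, degS, if_neg (by omega), if_neg (by omega)]; omega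
    have e2 : degOmega k (j + 1) = degOmega k j + 1 := by
      rw [degOmega, degOmega, if_neg (by omega), if_neg (by omega)]
    rw [e1, e2, D, if_neg (by omega), if_neg (by omega)]
    refine sections_sum _ fun A' _ => ?_
    simp only [sUp, mul_comm _ (eps _ _)]
    exact sections_linear_smul (fun B' => eps B' A') (sections_dTilde A' hf)

/-- The commuting variables transformed by `(a + bz)⁻¹`. -/
noncomputable def sigmaInv (h : BlockMat n) (s : Fin 2 → ℂ) (z : Z n) : Fin 2 → ℂ :=
  fun A' => ∑ B', (J₁ h z)⁻¹ B' A' * s B'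

/-- The commuting variables transformed by `(a + bz)ᵗ`. -/
noncomputable def sigmaT (h : BlockMat n) (s : Fin 2 → ℂ) (z : Z n) : Fin 2 → ℂ :=
  fun A' => ∑ B', (J₁ h z)ᵀ B' A' * s B'

theorem rep_of_le {k j : ℕ} (hjk : j ≤ k) (g : SL n) (f : SuperFun n) (z : Z n)
    (s : Fin 2 → ℂ) :
    rep k j g f z s = twist (g⁻¹ : SL n).1 (j + 1) (sigmaInv (g⁻¹ : SL n).1 s) f z := by
  simp only [rep, if_pos hjk]
  rfl

theorem rep_of_gt {k j : ℕ} (hjk : ¬ j ≤ k) (g : SL n) (f : SuperFun n) (z : Z n)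
    (s : Fin 2 → ℂ) :
    rep k j g f z s = twist (g⁻¹ : SL n).1 (j + 1) (sigmaT (g⁻¹ : SL n).1 s) f z := by
  simp only [rep, if_neg hjk]
  rfl

variable {h : BlockMat n} {z : Z n}

theorem contDiffAt_sigmaInv {m : ℕ∞ω} (hz : (J₁ h z).det ≠ 0) (s : Fin 2 → ℂ) :
    ContDiffAt ℂ m (sigmaInv h s) z :=
  contDiffAt_pi.2 fun A' => ContDiffAt.sum fun B' _ =>
    (contDiffAt_matrix.1 (contDiffAt_J₁_inv hz) B' A').mul contDiffAt_const

theorem contDiffAt_sigmaT {m : ℕ∞ω} (s : Fin 2 → ℂ) : ContDiffAt ℂ m (sigmaT h s) z :=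
  contDiffAt_pi.2 fun A' => ContDiffAt.sum fun B' _ =>
    (contDiffAt_matrix.1 contDiff_J₁.contDiffAt A' B').mul contDiffAt_const

theorem sections_rep {k j : ℕ} {f : SuperFun n} (g : SL n) (hf : f ∈ Gam n k j Set.univ) :
    rep k j g f ∈ Gam n k j (regular g) := by
  refine ⟨fun z _ => ?_, fun s z hz => ?_⟩
  · exact fiber_smul _ (fiber_map (substOmega _).toLinearMap (fun _ hv => substOmega_mem _ hv)
      (fiber_substS _ (hf.1 _ trivial)))
  · by_cases hjk : j ≤ k
    · simp only [rep_of_le hjk]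
      exact (contDiffAt_twist hz _ (contDiffAt_sigmaInv hz s) (sections_contDiff hf)).analyticAt
    · simp only [rep_of_gt hjk]
      exact (contDiffAt_twist hz _ (contDiffAt_sigmaT s) (sections_contDiff hf)).analyticAt

end Mapping

/-! ### Equivariance -/

section Equivariance

variable {n σ τ : ℕ} {h : BlockMat n} {z : Z n} {s : Fin 2 → ℂ} {f : SuperFun n}

theorem sections_differentiable (hf : f ∈ Sections n σ τ Set.univ) :
    Differentiable ℂ (fun q : Z n × (Fin 2 → ℂ) => f q.1 q.2) :=
  (sections_contDiff hf (m := 1)).differentiable one_ne_zero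

theorem twist_succ (m : ℕ) (ρ : Z n → Fin 2 → ℂ) (f : SuperFun n) (z : Z n) :
    twist h (m + 1) ρ f z = (J₁ h z).det⁻¹ • twist h m ρ f z := by
  simp only [twist, smul_smul, pow_succ', mul_inv]

theorem hasDerivAt_J₁_inv_apply (hz : (J₁ h z).det ≠ 0) (A : Fin (2 * n)) (A' B' C' : Fin 2) :
    HasDerivAt (fun t : ℂ => (J₁ h (z + t • Matrix.single A A' 1))⁻¹ B' C')
      (-(((J₁ h z)⁻¹ * h.toBlocks₁₂) B' A * (J₁ h z)⁻¹ A' C')) 0 := by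
  have := hasDerivAt_matrix.1 (hasDerivAt_J₁_inv hz (Matrix.single A A' 1)) B' C'
  refine this.congr_deriv ?_
  rw [← Matrix.mul_assoc, Matrix.neg_apply, mul_single_mul_apply]

/-- Since b is constant, only K varies, and its derivative along E_{AA'} is minus column A of Kb
times row A' of K; multiplying by b restores β_{A'}. -/
theorem hasDerivAt_beta (hz : (J₁ h z).det ≠ 0) (A : Fin (2 * n)) (A' B' : Fin 2) :
    HasDerivAt (fun t : ℂ => beta h (z + t • Matrix.single A A' 1) B')
      (-(((J₁ h z)⁻¹ * h.toBlocks₁₂) B' A) • beta h z A') 0 := by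
  rw [beta, ← map_smul]
  refine (iota n).hasFDerivAt.comp_hasDerivAt 0 (hasDerivAt_pi.2 fun C => ?_)
  simp only [Matrix.mul_apply (M := (J₁ h (z + _))⁻¹)]
  refine (HasDerivAt.fun_sum fun C' _ =>
    (hasDerivAt_J₁_inv_apply hz A A' B' C').mul_const (h.toBlocks₁₂ C' C)).congr_deriv ?_
  rw [Pi.smul_apply, Matrix.mul_apply (M := (J₁ h z)⁻¹) (i := A'), smul_eq_mul, Finset.mul_sum]
  exact Finset.sum_congr rfl fun C' _ => by ring

/-- `d_{A'}` of the twisted function, for the action on the commuting variables by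
`(a + bz)⁻¹`. -/
theorem dTilde_twist_sigmaInv (hz : (J₁ h z).det ≠ 0) (hf : f ∈ Sections n σ τ Set.univ) (m : ℕ)
    (A' : Fin 2) (s : Fin 2 → ℂ) :
    dTilde A' (fun z s => twist h m (sigmaInv h s) f z) z s =
      ((τ : ℂ) - m) • (beta h z A' * twist h m (sigmaInv h s) f z) -
      (∑ C', s C' • beta h z C') *
        ∑ B', (J₁ h z)⁻¹ A' B' • twist h m (sigmaInv h s) (ds B' f) z +
      ∑ B', (J₁ h z)⁻¹ A' B' • twist h m (sigmaInv h s) (dTilde B' f) z := by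
  have hσ : ∀ A, HasDerivAt (fun t : ℂ => sigmaInv h s (z + t • Matrix.single A A' 1))
      (fun B' => ∑ C', -(((J₁ h z)⁻¹ * h.toBlocks₁₂) C' A * (J₁ h z)⁻¹ A' B') * s C') 0 :=
    fun A => hasDerivAt_pi.2 fun B' => HasDerivAt.fun_sum fun C' _ =>
      (hasDerivAt_J₁_inv_apply hz A A' C' B').mul_const (s C')
  refine (sum_omega_mul_deriv_twist hz m τ A' hσ (sections_differentiable hf)
    (fiber_mem (hf.1 _ trivial) _)).trans ?_
  rw [sub_eq_add_neg (((τ : ℂ) - m) • _), Finset.mul_sum, ← Finset.sum_neg_distrib]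
  congr 2
  refine Finset.sum_congr rfl fun B' _ => ?_
  have e : iota n (fun A => ∑ C', -(((J₁ h z)⁻¹ * h.toBlocks₁₂) C' A * (J₁ h z)⁻¹ A' B') * s C') =
      -((J₁ h z)⁻¹ A' B' • ∑ C', s C' • beta h z C') := by
    simp only [beta, ← map_smul, ← map_sum, ← map_neg]
    congr 1
    ext A
    simp only [Pi.neg_apply, Pi.smul_apply, Finset.sum_apply, smul_eq_mul, Finset.mul_sum,
      ← Finset.sum_neg_distrib]
    exact Finset.sum_congr rfl fun C' _ => by ring
  rw [e, neg_mul, smul_mul_assoc, mul_smul_comm]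

/-- At fixed z only σ moves, linearly in s, so ∂_{C'} passes inside the twist with coefficients
K_{C'B'}. -/
theorem hasDerivAt_twist_sigmaInv (hf : f ∈ Sections n σ τ Set.univ) (m : ℕ)
    (z : Z n) (s : Fin 2 → ℂ) (C' : Fin 2) :
    HasDerivAt (fun t : ℂ => twist h m (sigmaInv h (s + t • Pi.single C' 1)) f z)
      (∑ B', (J₁ h z)⁻¹ C' B' • twist h m (sigmaInv h s) (ds B' f) z) 0 := by
  have h1 : HasDerivAt (fun t : ℂ => sigmaInv h (s + t • Pi.single C' 1) z)
      (fun B' => (J₁ h z)⁻¹ C' B') 0 := by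
    refine hasDerivAt_pi.2 fun B' => ?_
    have h2 := hasDerivAt_pi.1 (hasDerivAt_ds_line s C')
    refine (HasDerivAt.fun_sum fun D' _ => (h2 D').const_mul ((J₁ h z)⁻¹ D' B')).congr_deriv ?_
    simp [Pi.single_apply]
  have h2 := hasDerivAt_superFun (hasDerivAt_const (0 : ℂ) (frac h z)) h1
    (sections_differentiable hf _)
  have h3 := ((substOmegaL (J₂ h z)ᵀ).hasFDerivAt.comp_hasDerivAt (0 : ℂ) h2).fun_const_smul
    ((J₁ h z).det ^ m)⁻¹
  refine h3.congr_deriv ?_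
  simp only [zero_smul, add_zero, Matrix.zero_apply, Finset.sum_const_zero, zero_add, map_sum,
    map_smul, Finset.smul_sum, twist, substOmegaL_apply]
  exact Finset.sum_congr rfl fun B' _ => smul_comm _ _ _

theorem ds_eq_fderiv {f : SuperFun n} (hf : f ∈ Sections n σ τ Set.univ) (z : Z n)
    (s : Fin 2 → ℂ) (A' : Fin 2) : ds A' f z s = fderiv ℂ (f z) s (Pi.single A' 1) := by
  have h2 : HasFDerivAt (f z) (fderiv ℂ (f z) s) (s + (0 : ℂ) • (Pi.single A' 1 : Fin 2 → ℂ)) := by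
    have := (fiber_contDiff (hf.1 z trivial) (m := 1)).differentiable one_ne_zero s
    simpa using this.hasFDerivAt
  exact (h2.comp_hasDerivAt (0 : ℂ) (hasDerivAt_ds_line s A')).deriv

theorem fderiv_fderiv_apply {E F : Type*} [NormedAddCommGroup E] [NormedSpace ℂ E]
    [NormedAddCommGroup F] [NormedSpace ℂ F] {u : E → F} {x : E}
    (hd : DifferentiableAt ℂ (fderiv ℂ u) x) (v w : E) :
    fderiv ℂ (fun y => fderiv ℂ u y v) x w = fderiv ℂ (fderiv ℂ u) x w v := by
  rw [(hd.hasFDerivAt.clm_apply (hasFDerivAt_const v x)).fderiv]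
  simp

theorem ds_comm (hf : f ∈ Sections n (σ + 1) τ Set.univ) (A' B' : Fin 2) :
    ds A' (ds B' f) = ds B' (ds A' f) := by
  have key : ∀ A' B' z s, ds A' (ds B' f) z s =
      fderiv ℂ (fderiv ℂ (f z)) s (Pi.single A' 1) (Pi.single B' 1) := by
    intro A' B' z s
    have hc := fiber_contDiff (hf.1 z trivial) (m := 2)
    have hd : DifferentiableAt ℂ (fderiv ℂ (f z)) s :=
      (hc.fderiv_right (m := 1) le_rfl).differentiable one_ne_zero s
    rw [ds_eq_fderiv (sections_ds B' hf)]
    have e : ds B' f z = fun s => fderiv ℂ (f z) s (Pi.single B' 1) :=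
      funext fun s => ds_eq_fderiv hf z s B'
    rw [e]
    exact fderiv_fderiv_apply hd _ _
  funext z s
  rw [key, key]
  have hc := fiber_contDiff (hf.1 z trivial) (m := 2)
  exact hc.contDiffAt.isSymmSndFDerivAt (by simp) _ _

theorem dz_comm (hf : f ∈ Sections n σ τ Set.univ) (A B : Fin (2 * n)) (A' B' : Fin 2) :
    dz A A' (dz B B' f) = dz B B' (dz A A' f) := by
  have hC : ∀ s, ContDiff ℂ 2 (fun z => f z s) := fun s =>
    contDiff_iff_contDiffAt.2 fun z => (hf.2 s z trivial).contDiffAt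
  have hD : ∀ {f : SuperFun n}, f ∈ Sections n σ τ Set.univ → ∀ z s A A',
      dz A A' f z s = fderiv ℂ (fun z => f z s) z (Matrix.single A A' 1) :=
    fun hf z s A A' => dz_eq_fderiv (hf.2 s z trivial).differentiableAt A A'
  have key : ∀ A A' B B' z s, dz A A' (dz B B' f) z s =
      fderiv ℂ (fderiv ℂ (fun z => f z s)) z (Matrix.single A A' 1) (Matrix.single B B' 1) := by
    intro A A' B B' z s
    have hd : DifferentiableAt ℂ (fderiv ℂ (fun z => f z s)) z :=
      ((hC s).fderiv_right (m := 1) le_rfl).differentiable one_ne_zero z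
    rw [hD (sections_dz B B' hf), funext fun z => hD hf z s B B']
    exact fderiv_fderiv_apply hd _ _
  funext z s
  rw [key, key]
  exact (hC s).contDiffAt.isSymmSndFDerivAt (by simp) _ _

theorem dTilde_dTilde_eq_sum (hf : f ∈ Sections n σ τ Set.univ) (A' B' : Fin 2) (z : Z n)
    (s : Fin 2 → ℂ) : dTilde A' (dTilde B' f) z s =
      ∑ A, ∑ B, omega A * (omega B * dz A A' (dz B B' f) z s) := by
  refine Finset.sum_congr rfl fun A _ => ?_
  rw [← Finset.mul_sum]
  congr 1
  have hd : ∀ B, DifferentiableAt ℂ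
      (fun t : ℂ => dz B B' f (z + t • Matrix.single A A' 1) s) 0 := fun B =>
    DifferentiableAt.comp (0 : ℂ) ((sections_dz B B' hf).2 s _ trivial).differentiableAt
      (hasDerivAt_line z _).differentiableAt
  exact (HasDerivAt.fun_sum fun B _ =>
    (mulGrass n (omega B)).hasFDerivAt.comp_hasDerivAt (0 : ℂ) (hd B).hasDerivAt).deriv

/-- Partial derivatives commute while the ω^A anticommute. -/
theorem dTilde_anticomm (hf : f ∈ Sections n σ τ Set.univ) (A' B' : Fin 2) (z : Z n)
    (s : Fin 2 → ℂ) : dTilde A' (dTilde B' f) z s = -dTilde B' (dTilde A' f) z s := by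
  rw [dTilde_dTilde_eq_sum hf, dTilde_dTilde_eq_sum hf, Finset.sum_comm, ← Finset.sum_neg_distrib]
  refine Finset.sum_congr rfl fun A _ => ?_
  rw [← Finset.sum_neg_distrib]
  refine Finset.sum_congr rfl fun B _ => ?_
  rw [dz_comm hf, ← mul_assoc, ← mul_assoc, omega_eq_iota, omega_eq_iota, iota_mul_iota, neg_mul]

theorem dTilde_self (hf : f ∈ Sections n σ τ Set.univ) (A' : Fin 2) (z : Z n)
    (s : Fin 2 → ℂ) : dTilde A' (dTilde A' f) z s = 0 := by
  have h2 : (2 : ℂ) • dTilde A' (dTilde A' f) z s = 0 := by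
    rw [two_smul]
    exact add_eq_zero_iff_eq_neg.2 (dTilde_anticomm hf A' A' z s)
  exact (smul_eq_zero.1 h2).resolve_left two_ne_zero

end Equivariance

/-! ### The three cases j < k, j > k and j = k -/

section Cases

variable {n σ τ : ℕ} {h : BlockMat n} {z : Z n} {f : SuperFun n}

/-- Written in the entries of M⁻¹, the extra determinant factor can be matched with the
antisymmetrized products K K. -/
theorem det_inv_fin_two (M : Matrix (Fin 2) (Fin 2) ℂ) :
    M.det⁻¹ = M⁻¹ 0 0 * M⁻¹ 1 1 - M⁻¹ 0 1 * M⁻¹ 1 0 := by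
  rw [← Matrix.det_fin_two, Matrix.det_nonsing_inv, Ring.inverse_eq_inv']

/-- Equivariance of `∂^{A'} d_{A'}`. -/
theorem D_twist_of_lt (hz : (J₁ h z).det ≠ 0) (hf : f ∈ Sections n (σ + 1) τ Set.univ)
    (s : Fin 2 → ℂ) :
    ∑ A', dsUp A' (dTilde A' (fun z s => twist h (τ + 1) (sigmaInv h s) f z)) z s =
      twist h (τ + 2) (sigmaInv h s) (fun z s => ∑ A', dsUp A' (dTilde A' f) z s) z := by
  set m := τ + 1
  set X : Fin 2 → Fin 2 → Grass n := fun D' B' =>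
    twist h m (sigmaInv h s) (ds D' (ds B' f)) z
  set Y : Fin 2 → Fin 2 → Grass n := fun D' B' =>
    twist h m (sigmaInv h s) (ds D' (dTilde B' f)) z with hY
  set P : Fin 2 → Grass n := fun B' => twist h m (sigmaInv h s) (ds B' f) z
  have hX : X 1 0 = X 0 1 := by simp only [X, ds_comm hf 1 0]
  have hfun : ∀ A' s, dTilde A' (fun z s => twist h m (sigmaInv h s) f z) z s =
      -(beta h z A' * twist h m (sigmaInv h s) f z) -
      (∑ C', s C' • beta h z C') *
        ∑ B', (J₁ h z)⁻¹ A' B' • twist h m (sigmaInv h s) (ds B' f) z +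
      ∑ B', (J₁ h z)⁻¹ A' B' • twist h m (sigmaInv h s) (dTilde B' f) z := by
    intro A' s
    rw [dTilde_twist_sigmaInv hz hf]
    simp [m]
  -- The two β P terms are exchanged by A' ↔ C', which needs τ - m = -1. The X term is symmetric
  -- too, by `hX`. Thus only Y survives contraction with ε.
  have hds : ∀ C' A', ds C' (dTilde A' (fun z s => twist h m (sigmaInv h s) f z)) z s =
      -(beta h z A' * ∑ B', (J₁ h z)⁻¹ C' B' • P B') -
      (beta h z C' * ∑ B', (J₁ h z)⁻¹ A' B' • P B' +
        (∑ C', s C' • beta h z C') *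
          ∑ B', (J₁ h z)⁻¹ A' B' • ∑ D', (J₁ h z)⁻¹ C' D' • X D' B') +
      ∑ B', (J₁ h z)⁻¹ A' B' • ∑ D', (J₁ h z)⁻¹ C' D' • Y D' B' := by
    intro C' A'
    have h1 := hasDerivAt_twist_sigmaInv (h := h) hf m z s C'
    have h2 : ∀ B', _ := fun B' => hasDerivAt_twist_sigmaInv (h := h) (sections_ds B' hf) m z s C'
    have h3 : ∀ B', _ := fun B' =>
      hasDerivAt_twist_sigmaInv (h := h) (sections_dTilde B' hf) m z s C'
    have h4 : HasDerivAt (fun t : ℂ => ∑ D', (s + t • (Pi.single C' 1 : Fin 2 → ℂ)) D' •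
        beta h z D') (beta h z C') 0 := by
      have h5 := hasDerivAt_pi.1 (hasDerivAt_ds_line s C')
      refine (HasDerivAt.fun_sum fun D' _ => (h5 D').smul_const (beta h z D')).congr_deriv ?_
      simp [Pi.single_apply, ite_smul]
    have e : (fun t : ℂ => dTilde A' (fun z s => twist h m (sigmaInv h s) f z) z
        (s + t • Pi.single C' 1)) = _ := funext fun t => hfun A' _
    rw [ds, e]
    refine HasDerivAt.deriv ((HasDerivAt.fun_add (HasDerivAt.fun_sub (HasDerivAt.fun_neg
      ((mulGrass n (beta h z A')).hasFDerivAt.comp_hasDerivAt (0 : ℂ) h1))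
      (hasDerivAt_grass_mul h4 (HasDerivAt.fun_sum fun B' _ =>
        (h2 B').fun_const_smul ((J₁ h z)⁻¹ A' B'))))
      (HasDerivAt.fun_sum fun B' _ =>
        (h3 B').fun_const_smul ((J₁ h z)⁻¹ A' B'))).congr_deriv ?_)
    simp only [zero_smul, add_zero, mulGrass_apply, P, X, Y]
  have hR : twist h (τ + 2) (sigmaInv h s) (fun z s => ∑ A', dsUp A' (dTilde A' f) z s) z =
      (J₁ h z).det⁻¹ • (Y 1 0 - Y 0 1) := by
    rw [show τ + 2 = m + 1 from rfl, twist_succ]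
    congr 1
    simp only [dsUp, Fin.sum_univ_two, eps, Y, twist, ← smul_sub, ← map_sub]
    congr 2
    simp [sub_eq_add_neg]
  rw [hR, det_inv_fin_two]
  simp only [dsUp, hds, Fin.sum_univ_two, eps, Matrix.of_apply, Matrix.cons_val',
    Matrix.cons_val_zero, Matrix.cons_val_one, hX, mul_add, add_mul, smul_mul_assoc,
    mul_smul_comm, smul_add, smul_smul]
  simp
  module

/-- `d_{A'}` of the twisted function, for functions of `z` only. -/
theorem dTilde_twist_const (hz : (J₁ h z).det ≠ 0) (hf : f ∈ Sections n σ τ Set.univ) (m : ℕ)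
    (A' : Fin 2) (s : Fin 2 → ℂ) :
    dTilde A' (fun z s => twist h m (fun _ => s) f z) z s =
      ((τ : ℂ) - m) • (beta h z A' * twist h m (fun _ => s) f z) +
      ∑ B', (J₁ h z)⁻¹ A' B' • twist h m (fun _ => s) (dTilde B' f) z := by
  refine (sum_omega_mul_deriv_twist hz m τ A' (σ' := fun _ => 0)
    (fun A => hasDerivAt_const (0 : ℂ) s) (sections_differentiable hf)
    (fiber_mem (hf.1 _ trivial) _)).trans ?_
  have e : iota n (fun _ => 0) = 0 := map_zero _
  simp [e]

/-- `d_{A'}` of the twisted function, for the action on the commuting variables by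
`(a + bz)ᵗ`. -/
theorem dTilde_twist_sigmaT (hz : (J₁ h z).det ≠ 0) (hf : f ∈ Sections n σ τ Set.univ) (m : ℕ)
    (A' : Fin 2) (s : Fin 2 → ℂ) :
    dTilde A' (fun z s => twist h m (sigmaT h s) f z) z s =
      ((τ : ℂ) - m) • (beta h z A' * twist h m (sigmaT h s) f z) +
      s A' • ∑ B', iota n (h.toBlocks₁₂ B') * twist h m (sigmaT h s) (ds B' f) z +
      ∑ B', (J₁ h z)⁻¹ A' B' • twist h m (sigmaT h s) (dTilde B' f) z := by
  have hσ : ∀ A, HasDerivAt (fun t : ℂ => sigmaT h s (z + t • Matrix.single A A' 1))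
      (fun B' => s A' * h.toBlocks₁₂ B' A) 0 := by
    intro A
    refine hasDerivAt_pi.2 fun B' => (HasDerivAt.fun_sum fun C' _ =>
      (hasDerivAt_matrix.1 (hasDerivAt_J₁ z (Matrix.single A A' 1)) B' C').mul_const
        (s C')).congr_deriv ?_
    rw [Finset.sum_eq_single A']
    · rw [Matrix.mul_single_apply_same, mul_one, mul_comm]
    · intro C' _ hC
      rw [Matrix.mul_single_apply_of_ne _ _ _ _ _ hC, zero_mul]
    · simp
  refine (sum_omega_mul_deriv_twist hz m τ A' hσ (sections_differentiable hf)
    (fiber_mem (hf.1 _ trivial) _)).trans ?_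
  rw [Finset.smul_sum]
  congr 2
  refine Finset.sum_congr rfl fun B' _ => ?_
  rw [← smul_mul_assoc, ← map_smul]
  rfl

/-- Equivariance of `S^{A'} d_{A'}`. -/
theorem D_twist_of_gt (hz : (J₁ h z).det ≠ 0) (hf : f ∈ Sections n σ τ Set.univ)
    (s : Fin 2 → ℂ) :
    ∑ A', sUp s A' • dTilde A' (fun z s => twist h τ (sigmaT h s) f z) z s =
      twist h (τ + 1) (sigmaT h s) (fun z s => ∑ A', sUp s A' • dTilde A' f z s) z := by
  have hR : twist h (τ + 1) (sigmaT h s) (fun z s => ∑ A', sUp s A' • dTilde A' f z s) z =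
      (J₁ h z).det⁻¹ • ∑ A', sUp (sigmaT h s z) A' •
        twist h τ (sigmaT h s) (dTilde A' f) z := by
    rw [twist_succ]
    simp only [twist, map_sum, map_smul, Finset.smul_sum, smul_comm (_ ^ τ)⁻¹]
  -- For 2×2 matrices, ε conjugates the transpose into the adjugate, so raising the index turns J₁ᵗ
  -- into det(J₁) K.
  have hJ : ∀ B', ∑ A', sUp s A' * (J₁ h z)⁻¹ A' B' =
      (J₁ h z).det⁻¹ * sUp (sigmaT h s z) B' := by
    intro B'
    rw [Matrix.inv_def, Ring.inverse_eq_inv', Matrix.adjugate_fin_two]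
    fin_cases B' <;> simp [sUp, sigmaT, eps, Fin.sum_univ_two] <;> ring
  simp only [dTilde_twist_sigmaT hz hf, sub_self, zero_smul, zero_add, smul_add,
    Finset.sum_add_distrib]
  have h0 : ∀ v : Grass n, ∑ A', sUp s A' • s A' • v = 0 := by
    intro v
    simp only [smul_smul, ← Finset.sum_smul]
    simp [sUp, eps, Fin.sum_univ_two, mul_comm]
  rw [h0, zero_add, hR, Finset.smul_sum]
  simp only [Finset.smul_sum, smul_smul]
  rw [Finset.sum_comm]
  simp only [← Finset.sum_smul, hJ]

/-- Equivariance of `d_{0'} d_{1'}`. -/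
theorem D_twist_of_eq (hz : (J₁ h z).det ≠ 0) (hf : f ∈ Sections n σ τ Set.univ)
    (s : Fin 2 → ℂ) :
    dTilde 0 (dTilde 1 (fun z s => twist h (τ + 1) (fun _ => s) f z)) z s =
      twist h (τ + 2) (fun _ => s) (dTilde 0 (dTilde 1 f)) z := by
  set m := τ + 1
  set T : SuperFun n → Z n → Grass n := fun f z => twist h m (fun _ => s) f z with hT
  -- The first-order formula holds only where the determinant is nonzero; differentiating it again
  -- needs it near t = 0.
  have hreg : ∀ A, ∀ᶠ t : ℂ in nhds 0, (J₁ h (z + t • Matrix.single A 0 1)).det ≠ 0 := by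
    intro A
    have hc : ContinuousAt (fun t : ℂ => (J₁ h (z + t • Matrix.single A 0 1)).det) 0 :=
      (hasDerivAt_det_fin_two (hasDerivAt_J₁ (h := h) z (Matrix.single A 0 1))
        (by simpa using hz)).continuousAt
    exact hc.eventually_ne (by simpa using hz)
  have h1 : ∀ z, (J₁ h z).det ≠ 0 → dTilde 1 (fun z s => twist h m (fun _ => s) f z) z s =
      -(beta h z 1 * T f z) + ∑ B', (J₁ h z)⁻¹ 1 B' • T (dTilde B' f) z := by
    intro z hz
    rw [dTilde_twist_const hz hf]
    simp [m, T]
  have hTd : ∀ {σ τ : ℕ} {f : SuperFun n}, f ∈ Sections n σ τ Set.univ → ∀ A,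
      HasDerivAt (fun t : ℂ => T f (z + t • Matrix.single A 0 1))
        (deriv (fun t : ℂ => T f (z + t • Matrix.single A 0 1)) 0) 0 := by
    intro σ τ f hf A
    have h2 : DifferentiableAt ℂ (T f) (z + (0 : ℂ) • Matrix.single A 0 1) := by
      rw [zero_smul, add_zero]
      exact (contDiffAt_twist hz m contDiffAt_const
        (sections_contDiff hf (m := 1))).differentiableAt one_ne_zero
    exact (DifferentiableAt.comp (0 : ℂ) h2 (hasDerivAt_line z _).differentiableAt).hasDerivAt
  have hsum : ∀ {σ τ : ℕ} {f : SuperFun n}, f ∈ Sections n σ τ Set.univ →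
      ∑ A, omega A * deriv (fun t : ℂ => T f (z + t • Matrix.single A 0 1)) 0 =
      ((τ : ℂ) - m) • (beta h z 0 * T f z) + ∑ B', (J₁ h z)⁻¹ 0 B' • T (dTilde B' f) z :=
    fun hf => dTilde_twist_const hz hf m 0 s
  set γ := ((J₁ h z)⁻¹ * h.toBlocks₁₂) 1 with hγ
  set W := ∑ B', (J₁ h z)⁻¹ 0 B' • T (dTilde B' f) z with hW
  have hd : ∀ A, deriv (fun t : ℂ => dTilde 1 (fun z s => twist h m (fun _ => s) f z)
      (z + t • Matrix.single A 0 1) s) 0 =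
      γ A • (beta h z 0 * T f z) -
      beta h z 1 * deriv (fun t : ℂ => T f (z + t • Matrix.single A 0 1)) 0 - γ A • W +
      ∑ B', (J₁ h z)⁻¹ 1 B' •
        deriv (fun t : ℂ => T (dTilde B' f) (z + t • Matrix.single A 0 1)) 0 := by
    intro A
    have e : (fun t : ℂ => dTilde 1 (fun z s => twist h m (fun _ => s) f z)
      (z + t • Matrix.single A 0 1) s) =ᶠ[nhds 0] _ := (hreg A).mono fun t ht => h1 _ ht
    rw [e.deriv_eq]
    refine HasDerivAt.deriv ((HasDerivAt.fun_add
      (hasDerivAt_grass_mul (hasDerivAt_beta hz A 0 1) (hTd hf A)).fun_neg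
      (HasDerivAt.fun_sum fun B' _ => (hasDerivAt_J₁_inv_apply hz A 0 1 B').fun_smul
        (hTd (sections_dTilde B' hf) A))).congr_deriv ?_)
    simp only [zero_smul, add_zero, Finset.sum_add_distrib, neg_smul, Finset.sum_neg_distrib,
      mul_smul, ← Finset.smul_sum, ← hγ, ← hW, smul_mul_assoc, neg_mul]
    abel
  have hω : ∀ A (v : Grass n), omega A * (beta h z 1 * v) = -(beta h z 1 * (omega A * v)) := by
    intro A v
    rw [← mul_assoc, ← mul_assoc, omega_eq_iota, beta, iota_mul_iota, neg_mul]
  have hγs : ∀ v : Grass n, ∑ A, omega A * (γ A • v) = beta h z 1 * v := by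
    intro v
    simp only [beta, iota_eq_sum, Finset.sum_mul, mul_smul_comm, smul_mul_assoc, hγ]
  -- The functions d_{B'} f have Grassmann degree τ + 1 = m, so their β-term vanishes.
  have hsm : ∑ A, omega A * ∑ B', (J₁ h z)⁻¹ 1 B' •
        deriv (fun t : ℂ => T (dTilde B' f) (z + t • Matrix.single A 0 1)) 0 =
      ∑ B', (J₁ h z)⁻¹ 1 B' • ∑ C', (J₁ h z)⁻¹ 0 C' • T (dTilde C' (dTilde B' f)) z := by
    simp only [Finset.mul_sum, mul_smul_comm]
    rw [Finset.sum_comm]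
    refine Finset.sum_congr rfl fun B' _ => ?_
    rw [← Finset.smul_sum, hsum (sections_dTilde B' hf)]
    simp [m]
  have hL : dTilde 0 (dTilde 1 (fun z s => twist h m (fun _ => s) f z)) z s =
      ∑ B', (J₁ h z)⁻¹ 1 B' • ∑ C', (J₁ h z)⁻¹ 0 C' • T (dTilde C' (dTilde B' f)) z := by
    rw [← hsm]
    refine (Finset.sum_congr rfl fun A _ => congrArg (omega A * ·) (hd A)).trans ?_
    -- Differentiating β₁ gives β₁ β₀ T f, and differentiating K gives -β₁ W. Moving ω^A past β₁
    -- gives β₁(-β₀ T f + W), which cancels both.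
    simp only [mul_add, mul_sub, Finset.sum_add_distrib, Finset.sum_sub_distrib, hγs, hω,
      Finset.sum_neg_distrib, ← Finset.mul_sum, hsum hf, ← hW]
    have : (τ : ℂ) - m = -1 := by simp [m]
    rw [this, mul_smul_comm]
    module
  have hT0 : ∀ B', T (dTilde B' (dTilde B' f)) z = 0 := by
    intro B'
    simp only [T, twist, dTilde_self hf, map_zero, smul_zero]
  have hT1 : T (dTilde 1 (dTilde 0 f)) z = -T (dTilde 0 (dTilde 1 f)) z := by
    simp only [T, twist, dTilde_anticomm hf 1 0, map_neg, smul_neg]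
  rw [hL, show τ + 2 = m + 1 from rfl, twist_succ, det_inv_fin_two]
  simp only [Fin.sum_univ_two, hT0, hT1]
  simp only [T]
  module

end Cases

theorem D_rep {n k j : ℕ} (g : SL n) {f : SuperFun n} (hf : f ∈ Gam n k j Set.univ) {z : Z n}
    (hz : z ∈ regular g) (s : Fin 2 → ℂ) :
    D k j (rep k j g f) z s = rep k (j + 1) g (D k j f) z s := by
  have hDf := sections_D hf
  unfold Gam at hf hDf
  rcases lt_trichotomy j k with h | h | h
  · have e1 : degS k j = degS k (j + 1) + 1 := by
      rw [degS, degS, if_pos h.le, if_pos (by omega)]; omega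
    have e2 : degOmega k j = j := by rw [degOmega, if_pos h.le]
    rw [e1, e2] at hf
    rw [rep_of_le (by omega)]
    have e : rep k j g f = _ := funext fun z => funext fun s => rep_of_le h.le g f z s
    rw [e]
    simp only [D, if_pos h]
    exact D_twist_of_lt hz hf s
  · subst h
    have e1 : degS j j = 0 := by simp [degS]
    have e2 : degOmega j j = j := by simp [degOmega]
    have e3 : degS j (j + 1) = 0 := by simp [degS]
    rw [e1, e2] at hf
    rw [e3] at hDf
    -- In degree zero in s the substitution of the commuting variables is immaterial, so the change
    -- of convention between j = k and j = k + 1 does no harm.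
    have e : rep j j g f = fun z s => twist (g⁻¹ : SL n).1 (j + 1) (fun _ => s) f z := by
      funext z s
      rw [rep_of_le le_rfl, twist, twist, fiber_degree_zero (hf.1 _ trivial) _ s]
    have e' : rep j (j + 1) g (D j j f) z s =
        twist (g⁻¹ : SL n).1 (j + 2) (fun _ => s) (D j j f) z := by
      rw [rep_of_gt (by omega), twist, twist, fiber_degree_zero (hDf.1 _ trivial) _ s]
    rw [e', e]
    simp only [D, lt_irrefl, if_false, if_true]
    exact D_twist_of_eq hz hf s
  · have e2 : degOmega k j = j + 1 := by rw [degOmega, if_neg (by omega)]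
    rw [e2] at hf
    rw [rep_of_gt (by omega)]
    have e : rep k j g f = _ := funext fun z => funext fun s => rep_of_gt (by omega) g f z s
    rw [e]
    simp only [D, if_neg (show ¬ j < k by omega), if_neg (show ¬ j = k by omega)]
    exact D_twist_of_gt hz hf s

end CauchyFueter

theorem mainTheorem2 (n k j : ℕ) (hj : j + 2 ≤ 2 * n) :
    (∀ f ∈ CauchyFueter.Gam n k j Set.univ,
      CauchyFueter.D k j f ∈ CauchyFueter.Gam n k (j + 1) Set.univ) ∧
    ∀ g : CauchyFueter.SL n, ∀ f ∈ CauchyFueter.Gam n k j Set.univ,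
      CauchyFueter.rep k j g f ∈ CauchyFueter.Gam n k j (CauchyFueter.regular g) ∧
      ∀ z ∈ CauchyFueter.regular g, ∀ s : Fin 2 → ℂ,
        CauchyFueter.D k j (CauchyFueter.rep k j g f) z s =
          CauchyFueter.rep k (j + 1) g (CauchyFueter.D k j f) z s :=
  ⟨fun _ hf => CauchyFueter.sections_D hf, fun g _ hf =>
    ⟨CauchyFueter.sections_rep g hf, fun _ hz s => CauchyFueter.D_rep g hf hz s⟩⟩
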